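/- Let $k$ be a field and let $(\mathcal O,\mathfrak m)$ be a two-dimensional regular local ring essentially of finite type over $k$, with closed point $q$. Let $0\neq f\in\mathfrak m$ be such that the reduction of the curve $\{f=0\}\subset\operatorname{Spec}\mathcal O$ is singular at $q$ (that is, $\mathcal O/\sqrt{(f)}$ is not regular), and let $\nu$ be the order of $f$ at $\mathfrak m$. *Definitions.* Parameters are pairs of generators of $\mathfrak m$; expansions are finite sums $\sum c_{i,j}x^iy^j$ with $c_{i,j}\in\mathcal O^\times\cup\{0\}$. For parameters $(x,y)$ and an expansion $f=\sum c_{A,b}x^Ay^b$ put $$\Delta(f;x;y)=\operatorname{conv}\Big\{\tfrac{A}{\nu-b}+\mathbb R_{\ge 0}\ \Big|\ c_{A,b}\ne0,\ b<\nu\Big\}\subseteq\mathbb R$$ (this does not depend on the expansion) and $\delta(f;x;y)=\inf\Delta(f;x;y)\in\mathbb R\cup\{\infty\}$. Say that the initial form of $f$ is a power if $f\equiv u\,y^\nu \bmod \mathfrak m^{\nu+1}$ for some parameters $(x,y)$ and some unit $u$. Parameters $(x_1,x_2)$ are *characteristic* for $f$ if either the initial form of $f$ is not a power (then put $\delta=1$),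 or it is a power, $f\equiv u\,x_1^\nu\bmod\mathfrak m^{\nu+1}$ for some unit $u$, and $\Delta(f;x_2;x_1)$ is minimal for inclusion among all $\Delta(f;x_2;y)$ with $(x_2,y)$ parameters (then put $\delta=\delta(f;x_2;x_1)$). The *invariant* of $f$ at $q$ is $(a_1,a_2)=(\nu,\nu\delta)$, computed from characteristic parameters. For parameters $(y_1,y_2)$ and positive rationals $b_1,b_2$, the symbol $(y_1^{b_1},y_2^{b_2})$ denotes the monomial valuation of $\mathcal O$ with $y_1\mapsto 1/b_1$, $y_2\mapsto 1/b_2$; it is admissible for $g$ if $g$ has value at least $1$. The *center* of $f$ is $J=(x_1^{a_1},x_2^{a_2})$ for characteristic parameters $(x_1,x_2)$ and $(a_1,a_2)$ the invariant of $f$. The same terms are used for any nonzero element of $\mathfrak m$ in place of $f$. *Statement.* Let $(x_1,x_2)$ be characteristic parameters for $f$ and let $f=\sum c_{i,j}x_1^ix_2^j$ be an expansion. Then the invariant $(a_1,a_2)\in\mathbb Z_{>0}\times\mathbb Q$ of $f$ exists, satisfies $a_1\le a_2$, and it and the center $J=(x_1^{a_1},x_2^{a_2})$ of $f$ do not depend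 on the choice of characteristic parameters. Let $$f_{J,1}=\sum_{i/a_1+j/a_2=1}c_{i,j}\,x_1^ix_2^j$$ be the $J$-leading part of $f$. Then: 1. $f_{J,1}$ is a nonzero element of $\mathfrak m$, and the reduction of the curve $\{f_{J,1}=0\}$ is singular at $q$. 2. The invariant of $f_{J,1}$ at $q$ is (well defined and equal to) $(a_1,a_2)$. 3. $(x_1,x_2)$ are characteristic parameters for $f_{J,1}$, and the center of $f_{J,1}$ is (well defined and equal to) $J=(x_1^{a_1},x_2^{a_2})$. Moreover $J$ is admissible for $f_{J,1}$, the pair $(a_1,a_2)$ is lexicographically maximal among all pairs $(b_1,b_2)$ with $b_1\le b_2$ that belong to a center $(y_1^{b_1},y_2^{b_2})$ admissible for $f_{J,1}$, and $J$ is the only admissible center that attains this maximum. -/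

import Mathlib

open IsLocalRing

namespace PlaneCurve

noncomputable section

variable {O : Type*} [CommRing O] [IsLocalRing O]

/-- `(x, y)` is a regular system of parameters of a two-dimensional regular local ring:
the two elements generate the maximal ideal. -/
def IsParameters (x y : O) : Prop :=
  maximalIdeal O = Ideal.span {x, y}

/-- The order `ν = sup {n | f ∈ 𝔪 ^ n}` of `f` (finite for `f ≠ 0` in a Noetherian local ring). -/
def order (f : O) : ℕ :=
  sSup {n : ℕ | f ∈ maximalIdeal O ^ n}

/-- The equation `f = 0` defines a curve `C` through the closed point `q` of `Spec O`, and the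
reduction `C_red = Spec (O / √(f))` is singular (i.e. not regular) at `q`. -/
def HasSingularReduction (f : O) : Prop :=
  f ≠ 0 ∧ f ∈ maximalIdeal O ∧ ¬ IsRegularLocalRing (O ⧸ (Ideal.span {f}).radical)

/-- A finite expansion `f = ∑ c_{i,j} x ^ i y ^ j` whose coefficients are units or zero. -/
def IsExpansion (f x y : O) (c : ℕ × ℕ →₀ O) : Prop :=
  (∀ p, c p = 0 ∨ IsUnit (c p)) ∧ f = c.sum fun p u => u * x ^ p.1 * y ^ p.2

/-- The initial form of `f` in the graded ring of `O` is a nonzero constant times the `ν`-th power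
of the initial form of `y`, where `ν` is the order of `f`. -/
def InitialFormIsPowerOf (f y : O) : Prop :=
  ∃ u : O, IsUnit u ∧ f - u * y ^ order f ∈ maximalIdeal O ^ (order f + 1)

/-- The initial form of `f` is a polynomial in a single variable: up to a unit it is the `ν`-th
power of the class of a member `y` of some regular system of parameters `(x, y)`. -/
def InitialFormIsPower (f : O) : Prop :=
  ∃ x y : O, IsParameters x y ∧ InitialFormIsPowerOf f y

/-- The projected polyhedron `Δ(f; x; y) ⊆ ℝ`: the convex hull of the half-lines
`A / (ν - b) + ℝ_{≥ 0}`, for the monomials `x ^ A y ^ b` with `b < ν` that occur in an expansion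
of `f`. All expansions of `f` with respect to `(x, y)` give the same convex hull. -/
def projectedPolyhedron (f x y : O) : Set ℝ :=
  convexHull ℝ {r : ℝ | ∃ (c : ℕ × ℕ →₀ O) (A b : ℕ), IsExpansion f x y c ∧ c (A, b) ≠ 0 ∧
    b < order f ∧ (A : ℝ) / ((order f : ℝ) - (b : ℝ)) ≤ r}

/-- `δ(f; x; y) = inf Δ(f; x; y)`, which is `∞` if the polyhedron is empty. -/
def polyhedronDelta (f x y : O) : EReal :=
  sInf ((fun r : ℝ => (r : EReal)) '' projectedPolyhedron f x y)

/-- The regular systems of parameters `(x, z)` that compute the invariant and the centre of `f`.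
If the initial form of `f` is a power of a linear form, it has to be a power of the class of `z`
and `Δ(f; x; z)` has to be the characteristic polyhedron `Δ(f; x)`, that is, to be minimal among
all `Δ(f; x; y)`. If it is not such a power, there is no condition. -/
def IsCharacteristic (f x z : O) : Prop :=
  IsParameters x z ∧
    (InitialFormIsPower f →
      InitialFormIsPowerOf f z ∧
      ∀ y : O, IsParameters x y → projectedPolyhedron f x z ⊆ projectedPolyhedron f x y)

open Classical in
/-- The number `δ` read off from characteristic parameters `(x, z)`; by convention `δ = 1` if
the initial form of `f` is not a polynomial in a single variable. -/
def delta (f x z : O) : EReal :=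
  if InitialFormIsPower f then polyhedronDelta f x z else 1

/-- `a = (a₁, a₂)` is the invariant `(ν, δ ν)` of the curve `f = 0` at the closed point. -/
def IsInvariant (f : O) (a : ℕ × ℚ) : Prop :=
  ∃ x z : O, IsCharacteristic f x z ∧ a.1 = order f ∧
    ((a.2 : ℝ) : EReal) = ((order f : ℝ) : EReal) * delta f x z

/-- The ideal of elements of value at least `t` for the monomial valuation with
`x₁ ↦ 1 / a₁` and `x₂ ↦ 1 / a₂`; it is generated by monomials. -/
def valuationIdeal (x₁ x₂ : O) (a₁ a₂ t : ℚ) : Ideal O :=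
  Ideal.span {m : O | ∃ i j : ℕ, t ≤ (i : ℚ) / a₁ + (j : ℚ) / a₂ ∧ m = x₁ ^ i * x₂ ^ j}

/-- The centre `J = (x₁ ^ a₁, x₂ ^ a₂)`, that is, the monomial valuation `v_J` with
`v_J(x₁) = 1 / a₁` and `v_J(x₂) = 1 / a₂` (and `v_J(0) = ∞`). -/
def monomialValuation (x₁ x₂ : O) (a₁ a₂ : ℚ) (g : O) : EReal :=
  sSup {r : EReal | ∃ t : ℚ, g ∈ valuationIdeal x₁ x₂ a₁ a₂ t ∧ r = ((t : ℝ) : EReal)}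

/-- `v` is the centre of `f`: `v = (x₁ ^ a₁, x₂ ^ a₂)` with `(a₁, a₂)` the invariant of `f` and
`(x₁, x₂)` parameters such that `Δ(f; x₂; x₁)` is the characteristic polyhedron of `f`. -/
def IsCenter (f : O) (v : O → EReal) : Prop :=
  ∃ (x₁ x₂ : O) (a : ℕ × ℚ), IsCharacteristic f x₂ x₁ ∧ IsInvariant f a ∧
    v = monomialValuation x₁ x₂ a.1 a.2

/-- The centre `(x₁ ^ a₁, x₂ ^ a₂)` is admissible for `f`. -/
def IsAdmissible (f x₁ x₂ : O) (a₁ a₂ : ℚ) : Prop :=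
  1 ≤ monomialValuation x₁ x₂ a₁ a₂ f

/-- `J = (x₁ ^ a₁, x₂ ^ a₂)` is admissible for `f`, the pair `(a₁, a₂)` is lexicographically the
largest among all admissible centres `(y₁ ^ b₁, y₂ ^ b₂)` with `b₁ ≤ b₂`, and `J` is the only
admissible centre that attains this maximum. -/
def IsUniqueMaximalCenter (f x₁ x₂ : O) (a₁ a₂ : ℚ) : Prop :=
  IsAdmissible f x₁ x₂ a₁ a₂ ∧
    ∀ (y₁ y₂ : O) (b₁ b₂ : ℚ), IsParameters y₁ y₂ → 0 < b₁ → b₁ ≤ b₂ →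
      IsAdmissible f y₁ y₂ b₁ b₂ →
        toLex (b₁, b₂) ≤ toLex (a₁, a₂) ∧
        (b₁ = a₁ → b₂ = a₂ →
          monomialValuation y₁ y₂ b₁ b₂ = monomialValuation x₁ x₂ a₁ a₂)

/-- The `J`-leading part for `J = (x₁ ^ a₁, x₂ ^ a₂)`: the sum of the terms
`c_{i,j} x₁ ^ i x₂ ^ j` of valuation one in an expansion with coefficients `c`. -/
def leadingPart (x₁ x₂ : O) (a₁ a₂ : ℚ) (c : ℕ × ℕ →₀ O) : O :=
  ∑ p ∈ c.support with (p.1 : ℚ) / a₁ + (p.2 : ℚ) / a₂ = 1, c p * x₁ ^ p.1 * x₂ ^ p.2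

end

end PlaneCurve

/-! In a two-dimensional regular local ring, monomial ideals in parameters behave as in a polynomial
ring: a unit times a monomial lies in such an ideal only if some generating monomial divides it
(`IsParameters.exists_le_of_mem`, `IsExpansion.exists_le_of_mem`). Hence order, value and membership
in the polyhedron become membership in monomial ideals, and no choice of expansion matters.

The center is characterized by maximality. Write ν for the order. An admissible `(y₁^b₁, y₂^b₂)`
with `b₁ ≤ b₂` has `b₁ ≤ ν`. If `b₁ = ν < b₂`, the initial form is a power of that of `y₁`, so `y₂`
may be replaced by `x₂`. Admissibility then puts `Δ(f; x₂; y₁)` in `[b₂/ν, ∞)`, while minimality of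
the characteristic polyhedron puts δ into it; thus `b₂ ≤ νδ`. In case of equality,
`IsParameters.mem_valuationIdeal_of_mem` shows that `x₁` and `y₁` have value at least `1/ν` for each
other's valuation, so the valuations agree. Any two characteristic pairs therefore give the same
invariant and center.

The rest is a transfer from `f` to any `g` with `f - g` of value greater than 1
(`IsSlope.of_sub_mem`). The order and the initial form do not change. If the initial form is a
power, δ lies in every `Δ(g; x₂; y)`: a `y` that removed the vertex δ for `g` would remove it for
`f` too, because `f - g` stays of value greater than 1 in `(y, x₂)`. This makes `(x₁, x₂)`
characteristic for `g`. It also forces a singular reduction: otherwise `g` is a unit times a power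
of a parameter `z`, and `Δ(g; x₂; z)` is empty. -/

open IsLocalRing

namespace PlaneCurve

variable {O : Type*} [CommRing O]

/-! ### Parameters generate primes, and the ring is a domain -/

section Parameters

variable [IsLocalRing O]

theorem IsParameters.symm {x y : O} (h : IsParameters x y) : IsParameters y x := by
  rw [IsParameters, Set.pair_comm]; exact h

theorem IsParameters.left_mem {x y : O} (h : IsParameters x y) : x ∈ maximalIdeal O := by
  rw [h]; exact Ideal.subset_span (by simp)

theorem IsParameters.right_mem {x y : O} (h : IsParameters x y) : y ∈ maximalIdeal O :=
  h.symm.left_mem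

theorem IsParameters.exists_eq {x y a : O} (h : IsParameters x y) (ha : a ∈ maximalIdeal O) :
    ∃ b c : O, a = b * x + c * y := by
  rw [h, Ideal.mem_span_pair] at ha
  obtain ⟨b, c, e⟩ := ha
  exact ⟨b, c, e.symm⟩

theorem IsParameters.of_isUnit {x z y a b : O} (h : IsParameters x z) (ha : IsUnit a)
    (e : y = a * z + b * x) : IsParameters x y := by
  obtain ⟨u, rfl⟩ := ha
  rw [IsParameters, h, e]
  apply le_antisymm <;> rw [Ideal.span_le] <;> rintro w (hw | hw) <;> rw [hw]
  · exact Ideal.subset_span (by simp)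
  · rw [SetLike.mem_coe, Ideal.mem_span_pair]
    exact ⟨-(↑u⁻¹ * b), ↑u⁻¹, by linear_combination z * u.inv_mul⟩
  · exact Ideal.subset_span (by simp)
  · rw [SetLike.mem_coe, Ideal.mem_span_pair]
    exact ⟨b, u, by ring⟩

/-- An ideal `Q` of a Noetherian local ring with `Q ⊆ I + 𝔪 Q`, `I ⊆ Q`, equals `I`. -/
theorem eq_of_le_sup_maximalIdeal_smul [IsNoetherianRing O] {I Q : Ideal O} (hI : I ≤ Q)
    (h : Q ≤ I ⊔ maximalIdeal O • Q) : Q = I :=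
  le_antisymm (Submodule.le_of_le_smul_of_le_jacobson_bot (IsNoetherian.noetherian Q)
    (maximalIdeal_le_jacobson _) h) hI

variable [IsNoetherianRing O] (hdim : ringKrullDim O = 2)

include hdim

/-- By Krull's height theorem a minimal prime `Q` over `(x)` has height at most 1, so `y ∉ Q`. If `b
* x + c * y ∈ Q`, then `c ∈ Q`; hence `Q ≤ (x) + 𝔪 Q`, and Nakayama gives `Q = (x)`. -/
theorem IsParameters.isPrime_span {x y : O} (h : IsParameters x y) :
    (Ideal.span {x}).IsPrime := by
  have hx := h.left_mem
  have hne : Ideal.span {x} ≠ ⊤ := fun ht => by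
    have : Ideal.span {x} ≤ maximalIdeal O := by simpa [Ideal.span_le] using hx
    rw [ht] at this
    exact (maximalIdeal.isMaximal O).ne_top (top_le_iff.mp this)
  obtain ⟨Q, hQ⟩ := Ideal.nonempty_minimalPrimes hne
  have hQp : Q.IsPrime := hQ.1.1
  have hht : Q.height ≤ 1 := by
    have : (Ideal.span {x}).IsPrincipal := ⟨x, rfl⟩
    exact Ideal.height_le_one_of_isPrincipal_of_mem_minimalPrimes _ _ hQ
  have hyQ : y ∉ Q := fun hy => by
    have hxQ : x ∈ Q := hQ.1.2 (Ideal.mem_span_singleton_self x)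
    have hm : Q = maximalIdeal O := by
      refine le_antisymm (le_maximalIdeal hQp.ne_top) ?_
      rw [h, Ideal.span_le]
      rintro _ (rfl | rfl) <;> assumption
    have h2 := maximalIdeal_height_eq_ringKrullDim (R := O)
    rw [hdim, ← hm] at h2
    have h3 : ((Q.height : ℕ∞) : WithBot ℕ∞) ≤ ((1 : ℕ∞) : WithBot ℕ∞) :=
      WithBot.coe_le_coe.mpr hht
    rw [h2] at h3
    exact absurd h3 (by decide)
  have : Q = Ideal.span {x} := by
    refine eq_of_le_sup_maximalIdeal_smul hQ.1.2 fun a ha => ?_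
    obtain ⟨b, c, e⟩ := h.exists_eq (le_maximalIdeal hQp.ne_top ha)
    have hxQ : x ∈ Q := hQ.1.2 (Ideal.mem_span_singleton_self x)
    have hc : c ∈ Q := by
      have : c * y ∈ Q := by
        have := Q.sub_mem ha (Q.mul_mem_left b hxQ)
        rwa [e, add_sub_cancel_left] at this
      exact (hQp.mem_or_mem this).resolve_right hyQ
    rw [e, mul_comm c]
    exact Ideal.add_mem _ (Ideal.mem_sup_left (Ideal.mul_mem_left _ _
      (Ideal.mem_span_singleton_self x)))
      (Ideal.mem_sup_right (Submodule.smul_mem_smul h.right_mem hc))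
  exact this ▸ hQp

theorem maximalIdeal_ne_span_singleton (x : O) : maximalIdeal O ≠ Ideal.span {x} := fun h => by
  have : (maximalIdeal O).IsPrincipal := ⟨x, h⟩
  have hht := Ideal.height_le_one_of_isPrincipal_of_mem_minimalPrimes (maximalIdeal O)
    (maximalIdeal O) (by simp [Ideal.minimalPrimes_eq_subsingleton_self])
  have h2 := maximalIdeal_height_eq_ringKrullDim (R := O)
  rw [hdim] at h2
  have h3 : (((maximalIdeal O).height : ℕ∞) : WithBot ℕ∞) ≤ ((1 : ℕ∞) : WithBot ℕ∞) :=
    WithBot.coe_le_coe.mpr hht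
  rw [h2] at h3
  exact absurd h3 (by decide)

theorem IsParameters.right_notMem {x y : O} (h : IsParameters x y) : y ∉ Ideal.span {x} :=
  fun hy => maximalIdeal_ne_span_singleton hdim x <| by
    rw [h, Ideal.span_pair_eq_span_left_iff_dvd.mpr (Ideal.mem_span_singleton.mp hy)]

/-- The primes `(x + y ^ (n + 1))` are pairwise distinct, while there are only finitely many minimal
primes. So one of them is not minimal and contains a minimal prime `P` that misses its generator.
Then `P` equals that generator times `P`, and Nakayama gives `P = 0`. -/
theorem IsParameters.isDomain {x y : O} (h : IsParameters x y) : IsDomain O := by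
  have hpar : ∀ n : ℕ, IsParameters (x + y * y ^ n) y := fun n =>
    (h.symm.of_isUnit isUnit_one (by rw [one_mul, mul_comm])).symm
  have hinj : Function.Injective fun n : ℕ => Ideal.span {x + y * y ^ n} := by
    intro a b
    wlog hab : a < b generalizing a b
    · intro e
      rcases lt_or_eq_of_le (not_lt.mp hab) with h1 | h1
      · exact (this h1 e.symm).symm
      · exact h1.symm
    intro e
    exfalso
    dsimp only at e
    have hP := (hpar a).isPrime_span hdim
    have h1 : x + y * y ^ b ∈ Ideal.span {x + y * y ^ a} := by
      rw [e]; exact Ideal.mem_span_singleton_self _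
    have h2 := Ideal.sub_mem _ (Ideal.mem_span_singleton_self (x + y * y ^ a)) h1
    obtain ⟨d, rfl⟩ := Nat.exists_eq_add_of_lt hab
    have h3 : y ^ (a + 1) * (1 - y * y ^ d) ∈ Ideal.span {x + y * y ^ a} := by
      convert h2 using 1; ring
    rcases hP.mem_or_mem h3 with h4 | h4
    · exact (hpar a).right_notMem hdim (hP.mem_of_pow_mem _ h4)
    · refine hP.ne_top (Ideal.eq_top_of_isUnit_mem _ h4 ?_)
      have : y * y ^ d ∈ nonunits O := (mem_maximalIdeal _).mp (Ideal.mul_mem_right _ _ h.right_mem)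
      exact isUnit_one_sub_self_of_mem_nonunits _ this
  obtain ⟨n, hn⟩ : ∃ n : ℕ, Ideal.span {x + y * y ^ n} ∉ minimalPrimes O := by
    by_contra! hc
    exact Set.infinite_univ (Set.Finite.of_finite_image
      ((minimalPrimes.finite_of_isNoetherianRing O).subset
        (by rintro _ ⟨n, -, rfl⟩; exact hc n)) hinj.injOn)
  have hprime := (hpar n).isPrime_span hdim
  obtain ⟨P, hP, hle⟩ := Ideal.exists_minimalPrimes_le (I := ⊥) (J := Ideal.span {x + y * y ^ n})
    bot_le
  have hPp : P.IsPrime := hP.1.1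
  have hxP : x + y * y ^ n ∉ P := fun hmem => hn <| by
    have : P = Ideal.span {x + y * y ^ n} :=
      le_antisymm hle (by simpa [Ideal.span_le] using hmem)
    exact this ▸ hP
  have : P = ⊥ := by
    refine eq_of_le_sup_maximalIdeal_smul bot_le fun a ha => ?_
    obtain ⟨b, rfl⟩ := Ideal.mem_span_singleton.mp (hle ha)
    exact Ideal.mem_sup_right (Submodule.smul_mem_smul (hpar n).left_mem
      ((hPp.mem_or_mem ha).resolve_left hxP))
  rw [this] at hPp
  exact IsDomain.of_bot_isPrime O

end Parameters

end PlaneCurve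

/-! ### Monomial ideals and expansions -/

namespace PlaneCurve

variable {O : Type*} [CommRing O]

/-- The ideal generated by the monomials `x ^ i * y ^ j` with `(i, j) ∈ S`. -/
def monomialIdeal (x y : O) (S : Set (ℕ × ℕ)) : Ideal O :=
  Ideal.span ((fun p : ℕ × ℕ => x ^ p.1 * y ^ p.2) '' S)

theorem monomial_mem {x y : O} {S : Set (ℕ × ℕ)} {p : ℕ × ℕ} (hp : p ∈ S) :
    x ^ p.1 * y ^ p.2 ∈ monomialIdeal x y S :=
  Ideal.subset_span ⟨p, hp, rfl⟩

theorem monomial_mem_of_le {x y : O} {S : Set (ℕ × ℕ)} {p q : ℕ × ℕ} (hq : q ∈ S) (h : q ≤ p) :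
    x ^ p.1 * y ^ p.2 ∈ monomialIdeal x y S := by
  have : x ^ p.1 * y ^ p.2 = x ^ (p.1 - q.1) * y ^ (p.2 - q.2) * (x ^ q.1 * y ^ q.2) := by
    rw [mul_mul_mul_comm, ← pow_add, ← pow_add, Nat.sub_add_cancel h.1, Nat.sub_add_cancel h.2]
  rw [this]
  exact Ideal.mul_mem_left _ _ (monomial_mem hq)

theorem monomialIdeal_le {x y : O} {S : Set (ℕ × ℕ)} {I : Ideal O}
    (h : ∀ p ∈ S, x ^ p.1 * y ^ p.2 ∈ I) : monomialIdeal x y S ≤ I := by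
  rw [monomialIdeal, Ideal.span_le]
  rintro _ ⟨p, hp, rfl⟩
  exact h p hp

theorem monomialIdeal_mono {x y : O} {S T : Set (ℕ × ℕ)} (h : ∀ p ∈ S, ∃ q ∈ T, q ≤ p) :
    monomialIdeal x y S ≤ monomialIdeal x y T :=
  monomialIdeal_le fun p hp => by
    obtain ⟨q, hq, hle⟩ := h p hp
    exact monomial_mem_of_le hq hle

theorem monomialIdeal_subset {x y : O} {S T : Set (ℕ × ℕ)} (h : S ⊆ T) :
    monomialIdeal x y S ≤ monomialIdeal x y T :=
  monomialIdeal_mono fun p hp => ⟨p, h hp, le_rfl⟩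

theorem monomialIdeal_swap (x y : O) (S : Set (ℕ × ℕ)) :
    monomialIdeal x y S = monomialIdeal y x (Prod.swap ⁻¹' S) := by
  apply le_antisymm <;> refine monomialIdeal_le fun p hp => ?_ <;> rw [mul_comm]
  · exact monomial_mem (p := p.swap) (by simpa using hp)
  · exact monomial_mem (p := p.swap) hp

/-- The ideal `(x ^ (i + 1), y ^ (j + 1))` contains all monomials that do not divide `x ^ i * y ^ j`. -/
theorem monomialIdeal_le_span_pair {x y : O} {S : Set (ℕ × ℕ)} {p : ℕ × ℕ}
    (h : ∀ q ∈ S, ¬ q ≤ p) : monomialIdeal x y S ≤ Ideal.span {x ^ (p.1 + 1), y ^ (p.2 + 1)} :=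
  monomialIdeal_le fun q hq => by
    have : p.1 < q.1 ∨ p.2 < q.2 := by
      by_contra! hc
      exact h q hq ⟨hc.1, hc.2⟩
    rcases this with h1 | h1
    · exact Ideal.mul_mem_right _ _ (Ideal.mem_of_dvd _ (pow_dvd_pow x h1)
        (Ideal.subset_span (by simp)))
    · exact Ideal.mul_mem_left _ _ (Ideal.mem_of_dvd _ (pow_dvd_pow y h1)
        (Ideal.subset_span (by simp)))

theorem span_pair_le_span_pair {x y : O} {p q : ℕ × ℕ} (h : p ≤ q) :
    Ideal.span {x ^ (q.1 + 1), y ^ (q.2 + 1)} ≤ Ideal.span {x ^ (p.1 + 1), y ^ (p.2 + 1)} := by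
  rw [Ideal.span_le]
  rintro w (hw | hw) <;> rw [hw]
  · exact Ideal.mem_of_dvd _ (pow_dvd_pow x (Nat.succ_le_succ h.1)) (Ideal.subset_span (by simp))
  · exact Ideal.mem_of_dvd _ (pow_dvd_pow y (Nat.succ_le_succ h.2)) (Ideal.subset_span (by simp))

variable [IsLocalRing O]

theorem IsParameters.pow_maximalIdeal {x y : O} (h : IsParameters x y) (n : ℕ) :
    maximalIdeal O ^ n = monomialIdeal x y {p | n ≤ p.1 + p.2} := by
  apply le_antisymm
  · induction n with
    | zero =>
      rw [pow_zero, Ideal.one_eq_top, top_le_iff, Ideal.eq_top_iff_one]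
      simpa using monomial_mem (x := x) (y := y) (S := {p | 0 ≤ p.1 + p.2}) (p := (0, 0)) (by simp)
    | succ n ih =>
      rw [pow_succ, h]
      rw [h] at ih
      refine (Ideal.mul_mono_left ih).trans ?_
      rw [Ideal.mul_le]
      intro a ha b hb
      rw [Ideal.mem_span_pair] at hb
      obtain ⟨s, t, rfl⟩ := hb
      revert ha a
      change monomialIdeal x y {p | n ≤ p.1 + p.2} ≤
        Submodule.comap (LinearMap.mulRight O (s * x + t * y))
          (monomialIdeal x y {p | n + 1 ≤ p.1 + p.2})
      refine monomialIdeal_le fun p (hp : n ≤ p.1 + p.2) => ?_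
      have e : x ^ p.1 * y ^ p.2 * (s * x + t * y) = s * (x ^ (p.1 + 1) * y ^ p.2) +
        t * (x ^ p.1 * y ^ (p.2 + 1)) := by ring
      simp only [Submodule.mem_comap, LinearMap.mulRight_apply]
      rw [e]
      exact Ideal.add_mem _
        (Ideal.mul_mem_left _ _ (monomial_mem (p := (p.1 + 1, p.2)) (by simp; omega)))
        (Ideal.mul_mem_left _ _ (monomial_mem (p := (p.1, p.2 + 1)) (by simp; omega)))
  · refine monomialIdeal_le fun p (hp : n ≤ p.1 + p.2) => ?_
    refine Ideal.pow_le_pow_right hp ?_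
    rw [pow_add]
    exact Ideal.mul_mem_mul (Ideal.pow_mem_pow h.left_mem _) (Ideal.pow_mem_pow h.right_mem _)

variable [IsNoetherianRing O] (hdim : ringKrullDim O = 2)

include hdim

/-- As `x` and `y` are primes that do not divide each other, `x ^ a * y ^ b` can be cancelled from a
relation, which would leave the unit `u` in `(x, y)`. -/
theorem IsParameters.unit_mul_monomial_notMem {x y u : O} (h : IsParameters x y) (hu : IsUnit u)
    (a b : ℕ) : u * (x ^ a * y ^ b) ∉ Ideal.span {x ^ (a + 1), y ^ (b + 1)} := by
  have := h.isDomain hdim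
  have hpx := h.isPrime_span hdim
  have hpy := h.symm.isPrime_span hdim
  have hy := h.right_notMem hdim
  have hx := h.symm.right_notMem hdim
  have hx0 : x ≠ 0 := fun e => hx (e ▸ Ideal.zero_mem _)
  have hy0 : y ≠ 0 := fun e => hy (e ▸ Ideal.zero_mem _)
  rw [Ideal.span_singleton_prime hx0] at hpx
  rw [Ideal.span_singleton_prime hy0] at hpy
  rw [Ideal.mem_span_singleton] at hx hy
  rw [Ideal.mem_span_pair]
  rintro ⟨s, t, e⟩
  have h1 : x ^ a ∣ t * y ^ (b + 1) := ⟨u * y ^ b - s * x, by linear_combination e⟩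
  obtain ⟨t', rfl⟩ := hpx.pow_dvd_of_dvd_mul_right a (fun hd => hy (hpx.dvd_of_dvd_pow hd)) h1
  have h2 : y ^ b ∣ s * x ^ (a + 1) := ⟨u * x ^ a - x ^ a * t' * y, by linear_combination e⟩
  obtain ⟨s', rfl⟩ := hpy.pow_dvd_of_dvd_mul_right b (fun hd => hx (hpy.dvd_of_dvd_pow hd)) h2
  have h3 : x ^ a * y ^ b ≠ 0 := mul_ne_zero (pow_ne_zero _ hx0) (pow_ne_zero _ hy0)
  have h4 : u = s' * x + t' * y := mul_right_cancel₀ h3 (by linear_combination -e)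
  have : u ∈ maximalIdeal O := by
    rw [h4]
    exact Ideal.add_mem _ (Ideal.mul_mem_left _ _ h.left_mem) (Ideal.mul_mem_left _ _ h.right_mem)
  exact (mem_maximalIdeal u).mp this hu

theorem IsParameters.exists_le_of_mem {x y u : O} (h : IsParameters x y) (hu : IsUnit u)
    {p : ℕ × ℕ} {S : Set (ℕ × ℕ)} (hp : u * (x ^ p.1 * y ^ p.2) ∈ monomialIdeal x y S) :
    ∃ q ∈ S, q ≤ p := by
  by_contra! hc
  exact h.unit_mul_monomial_notMem hdim hu p.1 p.2 (monomialIdeal_le_span_pair hc hp)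

/-- A minimal offending exponent `p'` cannot be cancelled by the other terms: its monomial would be
divisible by a generator from `S` or by another offending monomial. This is what makes values and
polyhedra independent of the expansion. -/
theorem IsExpansion.exists_le_of_mem {f x y : O} {c : ℕ × ℕ →₀ O} (hc : IsExpansion f x y c)
    (h : IsParameters x y) {S : Set (ℕ × ℕ)} (hf : f ∈ monomialIdeal x y S) {p : ℕ × ℕ}
    (hp : c p ≠ 0) : ∃ q ∈ S, q ≤ p := by
  by_contra hbad
  obtain ⟨p', -, hmin⟩ := exists_minimal_le_of_wellFoundedLT
    (fun p => c p ≠ 0 ∧ ¬ ∃ q ∈ S, q ≤ p) p ⟨hp, hbad⟩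
  obtain ⟨hp', hbad'⟩ := hmin.prop
  let T : Set (ℕ × ℕ) := S ∪ {q | c q ≠ 0 ∧ q ≠ p'}
  have hmem : c p' * (x ^ p'.1 * y ^ p'.2) ∈ monomialIdeal x y T := by
    have e : c p' * (x ^ p'.1 * y ^ p'.2) =
        f - ∑ q ∈ c.support.erase p', c q * x ^ q.1 * y ^ q.2 := by
      rw [hc.2, Finsupp.sum, ← Finset.add_sum_erase _ _ (Finsupp.mem_support_iff.mpr hp'),
        add_sub_cancel_right, mul_assoc]
    rw [e]
    refine Ideal.sub_mem _ (monomialIdeal_subset Set.subset_union_left hf)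
      (Ideal.sum_mem _ fun q hq => ?_)
    rw [mul_assoc]
    rw [Finset.mem_erase, Finsupp.mem_support_iff] at hq
    exact Ideal.mul_mem_left _ _ (monomial_mem (Or.inr ⟨hq.2, hq.1⟩))
  obtain ⟨q, hq, hle⟩ := h.exists_le_of_mem hdim ((hc.1 p').resolve_left hp') hmem
  rcases hq with hq | ⟨hq0, hne⟩
  · exact hbad' ⟨q, hq, hle⟩
  · by_cases hgood : ∃ r ∈ S, r ≤ q
    · obtain ⟨r, hr, hrq⟩ := hgood
      exact hbad' ⟨r, hr, hrq.trans hle⟩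
    · exact hne (le_antisymm hle (hmin.le_of_le ⟨hq0, hgood⟩ hle))

omit hdim [IsLocalRing O] [IsNoetherianRing O] in
theorem IsExpansion.mem_monomialIdeal {f x y : O} {c : ℕ × ℕ →₀ O} (hc : IsExpansion f x y c)
    {S : Set (ℕ × ℕ)} (hS : ∀ p, c p ≠ 0 → p ∈ S) : f ∈ monomialIdeal x y S := by
  rw [hc.2]
  refine Ideal.sum_mem _ fun p hp => ?_
  dsimp only
  rw [mul_assoc]
  exact Ideal.mul_mem_left _ _ (monomial_mem (hS p (Finsupp.mem_support_iff.mp hp)))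

omit hdim in
-- Krull's intersection theorem in `O ⧸ I`.
theorem mem_of_forall_mem_sup_pow {I : Ideal O} {f : O}
    (h : ∀ n : ℕ, f ∈ I ⊔ maximalIdeal O ^ n) : f ∈ I := by
  have hk := Ideal.iInf_pow_smul_eq_bot_of_isLocalRing (M := O ⧸ I) (maximalIdeal O)
    (maximalIdeal.isMaximal O).ne_top
  rw [← Ideal.Quotient.eq_zero_iff_mem, ← Submodule.mem_bot O, ← hk, Submodule.mem_iInf]
  intro n
  obtain ⟨a, ha, b, hb, rfl⟩ := Submodule.mem_sup.mp (h n)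
  rw [map_add, Ideal.Quotient.eq_zero_iff_mem.mpr ha, zero_add]
  have : Ideal.Quotient.mk I b = b • (1 : O ⧸ I) := by
    rw [Algebra.smul_def, mul_one]; rfl
  rw [this]
  exact Submodule.smul_mem_smul hb trivial

/-- Successive approximation modulo powers of the maximal ideal: a degree `n` term with exponent
outside the set cannot have a unit coefficient, so it moves into degree `n + 1`. -/
theorem IsParameters.mem_monomialIdeal_setOf_notMem {x y : O} (h : IsParameters x y) (f : O) :
    f ∈ monomialIdeal x y {p | f ∉ Ideal.span {x ^ (p.1 + 1), y ^ (p.2 + 1)}} := by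
  set S : Set (ℕ × ℕ) := {p | f ∉ Ideal.span {x ^ (p.1 + 1), y ^ (p.2 + 1)}} with hS
  refine mem_of_forall_mem_sup_pow fun n => ?_
  induction n with
  | zero => simp
  | succ n ih =>
    obtain ⟨s, hs, r, hr, hf⟩ := Submodule.mem_sup.mp ih
    have hr' := hr
    rw [h.pow_maximalIdeal, monomialIdeal, Ideal.span,
      Finsupp.mem_span_image_iff_linearCombination] at hr'
    obtain ⟨l, hl, rfl⟩ := hr'
    rw [Finsupp.linearCombination_apply, Finsupp.sum] at hf
    rw [← hf]
    refine Ideal.add_mem _ (Ideal.mem_sup_left hs) (Ideal.sum_mem _ fun p hp => ?_)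
    rw [smul_eq_mul]
    have hpn : n ≤ p.1 + p.2 := hl hp
    by_cases hpS : p ∈ S
    · exact Ideal.mem_sup_left (Ideal.mul_mem_left _ _ (monomial_mem hpS))
    refine Ideal.mem_sup_right ?_
    rcases hpn.lt_or_eq with hlt | heq
    · rw [h.pow_maximalIdeal]
      exact Ideal.mul_mem_left _ _ (monomial_mem hlt)
    · have hnu : l p ∈ maximalIdeal O := by
        rw [mem_maximalIdeal]
        intro hu
        refine h.unit_mul_monomial_notMem hdim hu p.1 p.2 ?_
        have e : l p * (x ^ p.1 * y ^ p.2) =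
            f - s - ∑ q ∈ l.support.erase p, l q * (x ^ q.1 * y ^ q.2) := by
          rw [← hf, ← Finset.add_sum_erase _ _ hp]
          simp only [smul_eq_mul]
          ring
        rw [e]
        refine Ideal.sub_mem _ (Ideal.sub_mem _ (not_not.mp hpS)
          (monomialIdeal_le_span_pair (S := S) (fun q hq hqp => hq
            (span_pair_le_span_pair hqp (not_not.mp hpS))) hs)) ?_
        · refine monomialIdeal_le_span_pair (S := {q | q ∈ l.support ∧ q ≠ p}) ?_
            (Ideal.sum_mem _ fun q hq => Ideal.mul_mem_left _ _
              (monomial_mem ⟨(Finset.mem_erase.mp hq).2, (Finset.mem_erase.mp hq).1⟩))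
          rintro q ⟨hq, hne⟩ hle
          have hqn : n ≤ q.1 + q.2 := hl hq
          have h1 := hle.1
          have h2 := hle.2
          exact hne (Prod.ext (by omega) (by omega))
      rw [pow_succ']
      refine Ideal.mul_mem_mul hnu (Ideal.pow_le_pow_right hpn ?_)
      rw [pow_add]
      exact Ideal.mul_mem_mul (Ideal.pow_mem_pow h.left_mem _) (Ideal.pow_mem_pow h.right_mem _)

/-- Only the minimal exponents `p` with `f ∉ (x ^ (p.1 + 1), y ^ (p.2 + 1))` are used. They form an
antichain, so a nonzero non-unit coefficient at `p` would put all of `f` into that ideal. -/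
theorem IsParameters.exists_isExpansion {x y : O} (h : IsParameters x y) (f : O) :
    ∃ c, IsExpansion f x y c := by
  set S : Set (ℕ × ℕ) := {p | f ∉ Ideal.span {x ^ (p.1 + 1), y ^ (p.2 + 1)}} with hS
  have hf : f ∈ monomialIdeal x y {p | Minimal (· ∈ S) p} :=
    monomialIdeal_mono (fun p hp => by
      obtain ⟨q, hq, hmin⟩ := exists_minimal_le_of_wellFoundedLT (· ∈ S) p hp
      exact ⟨q, hmin, hq⟩) (h.mem_monomialIdeal_setOf_notMem hdim f)
  rw [monomialIdeal, Ideal.span, Finsupp.mem_span_image_iff_linearCombination] at hf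
  obtain ⟨c, hc, e⟩ := hf
  rw [Finsupp.linearCombination_apply, Finsupp.sum] at e
  refine ⟨c, fun p => ?_, by rw [← e]; exact Finset.sum_congr rfl fun p _ => (mul_assoc _ _ _).symm⟩
  by_contra! hp
  have hpS : Minimal (· ∈ S) p := hc (Finsupp.mem_support_iff.mpr hp.1)
  refine hpS.prop ?_
  rw [← e, ← Finset.add_sum_erase _ _ (Finsupp.mem_support_iff.mpr hp.1)]
  refine Ideal.add_mem _ ?_ ?_
  · obtain ⟨s, t, e'⟩ := h.exists_eq ((mem_maximalIdeal _).mpr hp.2)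
    rw [Ideal.mem_span_pair]
    exact ⟨s * y ^ p.2, t * x ^ p.1, by rw [e', smul_eq_mul]; ring⟩
  · refine monomialIdeal_le_span_pair (S := {q | q ∈ c.support ∧ q ≠ p}) ?_
      (Ideal.sum_mem _ fun q hq => Ideal.mul_mem_left _ _
        (monomial_mem ⟨(Finset.mem_erase.mp hq).2, (Finset.mem_erase.mp hq).1⟩))
    rintro q ⟨hq, hne⟩ hle
    exact hne (le_antisymm hle (hpS.le_of_le (hc hq).prop hle))

end PlaneCurve

/-! ### Monomial valuations, order and initial forms -/

namespace PlaneCurve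

variable {O : Type*} [CommRing O]

theorem valuationIdeal_eq (x₁ x₂ : O) (a₁ a₂ t : ℚ) : valuationIdeal x₁ x₂ a₁ a₂ t =
    monomialIdeal x₁ x₂ {p | t ≤ (p.1 : ℚ) / a₁ + (p.2 : ℚ) / a₂} := by
  rw [valuationIdeal, monomialIdeal]
  congr 1
  ext m
  constructor
  · rintro ⟨i, j, h, rfl⟩
    exact ⟨(i, j), h, rfl⟩
  · rintro ⟨p, h, rfl⟩
    exact ⟨p.1, p.2, h, rfl⟩

theorem monomial_mem_valuationIdeal {x₁ x₂ : O} {a₁ a₂ t : ℚ} {i j : ℕ}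
    (h : t ≤ (i : ℚ) / a₁ + (j : ℚ) / a₂) : x₁ ^ i * x₂ ^ j ∈ valuationIdeal x₁ x₂ a₁ a₂ t :=
  Ideal.subset_span ⟨i, j, h, rfl⟩

theorem left_mem_valuationIdeal (x₁ x₂ : O) (a₁ a₂ : ℚ) :
    x₁ ∈ valuationIdeal x₁ x₂ a₁ a₂ (1 / a₁) := by
  simpa using monomial_mem_valuationIdeal (x₁ := x₁) (x₂ := x₂) (a₁ := a₁) (a₂ := a₂)
    (t := 1 / a₁) (i := 1) (j := 0) (by simp)

theorem right_mem_valuationIdeal (x₁ x₂ : O) (a₁ a₂ : ℚ) :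
    x₂ ∈ valuationIdeal x₁ x₂ a₁ a₂ (1 / a₂) := by
  simpa using monomial_mem_valuationIdeal (x₁ := x₁) (x₂ := x₂) (a₁ := a₁) (a₂ := a₂)
    (t := 1 / a₂) (i := 0) (j := 1) (by simp)

theorem valuationIdeal_anti (x₁ x₂ : O) (a₁ a₂ : ℚ) {s t : ℚ} (h : s ≤ t) :
    valuationIdeal x₁ x₂ a₁ a₂ t ≤ valuationIdeal x₁ x₂ a₁ a₂ s := by
  rw [valuationIdeal_eq, valuationIdeal_eq]
  exact monomialIdeal_subset fun p (hp : t ≤ _) => h.trans hp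

theorem mul_mem_valuationIdeal {x₁ x₂ g h : O} {a₁ a₂ s t : ℚ}
    (hg : g ∈ valuationIdeal x₁ x₂ a₁ a₂ s) (hh : h ∈ valuationIdeal x₁ x₂ a₁ a₂ t) :
    g * h ∈ valuationIdeal x₁ x₂ a₁ a₂ (s + t) := by
  have : valuationIdeal x₁ x₂ a₁ a₂ s * valuationIdeal x₁ x₂ a₁ a₂ t ≤
      valuationIdeal x₁ x₂ a₁ a₂ (s + t) := by
    rw [valuationIdeal, valuationIdeal, Ideal.span_mul_span', Ideal.span_le]
    rintro _ ⟨_, ⟨i, j, h1, rfl⟩, _, ⟨k, l, h2, rfl⟩, rfl⟩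
    have e : x₁ ^ i * x₂ ^ j * (x₁ ^ k * x₂ ^ l) = x₁ ^ (i + k) * x₂ ^ (j + l) := by ring
    simp only [SetLike.mem_coe, e]
    refine monomial_mem_valuationIdeal ?_
    push_cast
    rw [add_div, add_div]
    linarith
  exact this (Ideal.mul_mem_mul hg hh)

theorem pow_mem_valuationIdeal {x₁ x₂ g : O} {a₁ a₂ s : ℚ}
    (hg : g ∈ valuationIdeal x₁ x₂ a₁ a₂ s) (n : ℕ) :
    g ^ n ∈ valuationIdeal x₁ x₂ a₁ a₂ (n * s) := by
  induction n with
  | zero =>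
    simpa using monomial_mem_valuationIdeal (x₁ := x₁) (x₂ := x₂) (a₁ := a₁) (a₂ := a₂)
      (t := 0) (i := 0) (j := 0) (by simp)
  | succ n ih =>
    rw [pow_succ]
    rw [Nat.cast_succ, add_mul, one_mul]
    exact mul_mem_valuationIdeal ih hg

theorem monomial_mem_valuationIdeal_of_mem {x₁ x₂ y₁ y₂ : O} {a₁ a₂ : ℚ}
    (h₁ : y₁ ∈ valuationIdeal x₁ x₂ a₁ a₂ (1 / a₁))
    (h₂ : y₂ ∈ valuationIdeal x₁ x₂ a₁ a₂ (1 / a₂)) (i j : ℕ) :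
    y₁ ^ i * y₂ ^ j ∈ valuationIdeal x₁ x₂ a₁ a₂ ((i : ℚ) / a₁ + (j : ℚ) / a₂) := by
  rw [div_eq_mul_one_div (i : ℚ), div_eq_mul_one_div (j : ℚ)]
  exact mul_mem_valuationIdeal (pow_mem_valuationIdeal h₁ i) (pow_mem_valuationIdeal h₂ j)

theorem valuationIdeal_le_valuationIdeal {x₁ x₂ y₁ y₂ : O} {a₁ a₂ : ℚ}
    (h₁ : y₁ ∈ valuationIdeal x₁ x₂ a₁ a₂ (1 / a₁))
    (h₂ : y₂ ∈ valuationIdeal x₁ x₂ a₁ a₂ (1 / a₂)) (t : ℚ) :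
    valuationIdeal y₁ y₂ a₁ a₂ t ≤ valuationIdeal x₁ x₂ a₁ a₂ t := by
  rw [valuationIdeal_eq y₁]
  exact monomialIdeal_le fun p (hp : t ≤ _) =>
    valuationIdeal_anti _ _ _ _ hp (monomial_mem_valuationIdeal_of_mem h₁ h₂ _ _)

theorem monomialIdeal_lt_le {x₁ x₂ y₁ y₂ : O} {a₁ a₂ : ℚ}
    (h₁ : y₁ ∈ valuationIdeal x₁ x₂ a₁ a₂ (1 / a₁))
    (h₂ : y₂ ∈ valuationIdeal x₁ x₂ a₁ a₂ (1 / a₂)) (t : ℚ) :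
    monomialIdeal y₁ y₂ {p | t < (p.1 : ℚ) / a₁ + (p.2 : ℚ) / a₂} ≤
      monomialIdeal x₁ x₂ {p | t < (p.1 : ℚ) / a₁ + (p.2 : ℚ) / a₂} :=
  monomialIdeal_le fun p (hp : t < _) => by
    have := monomial_mem_valuationIdeal_of_mem h₁ h₂ p.1 p.2
    rw [valuationIdeal_eq] at this
    exact monomialIdeal_subset (fun q (hq : _ ≤ _) => hp.trans_le hq) this

theorem monomialValuation_congr {x₁ x₂ y₁ y₂ : O} {a₁ a₂ : ℚ}
    (h : ∀ t, valuationIdeal y₁ y₂ a₁ a₂ t = valuationIdeal x₁ x₂ a₁ a₂ t) :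
    monomialValuation y₁ y₂ a₁ a₂ = monomialValuation x₁ x₂ a₁ a₂ := by
  funext g
  simp only [monomialValuation, h]

theorem isAdmissible_of_mem {g x₁ x₂ : O} {a₁ a₂ : ℚ} (h : g ∈ valuationIdeal x₁ x₂ a₁ a₂ 1) :
    IsAdmissible g x₁ x₂ a₁ a₂ :=
  le_sSup ⟨1, h, by simp⟩

/-- A monomial other than `x ^ ν` of value at least one for the weights `1 / ν` and `1 / b`, where
`m * ν < b`, has value greater than `ν` for the weights `1` and `1 / m`. -/
theorem lt_weight_of_ne {ν m : ℕ} {b : ℚ} (hν : 0 < ν) (hm : 0 < m) (hb : (m : ℚ) * ν < b)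
    {p : ℕ × ℕ} (hp : p ≠ (ν, 0)) (h : 1 ≤ (p.1 : ℚ) / ν + (p.2 : ℚ) / b) :
    (ν : ℚ) < (p.1 : ℚ) + (p.2 : ℚ) / m := by
  obtain ⟨i, j⟩ := p
  have hν' : (0 : ℚ) < ν := by exact_mod_cast hν
  have hm' : (0 : ℚ) < m := by exact_mod_cast hm
  dsimp only at h ⊢
  rcases Nat.eq_zero_or_pos j with rfl | hj
  · have h1 : (ν : ℚ) ≤ i := by
      rw [Nat.cast_zero, zero_div, add_zero, le_div_iff₀ hν', one_mul] at h
      exact h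
    have h2 : ν ≤ i := by exact_mod_cast h1
    have h3 : i ≠ ν := fun e => hp (by rw [e])
    have h4 : (ν : ℚ) < i := by exact_mod_cast lt_of_le_of_ne h2 h3.symm
    simpa using h4
  · have hj' : (0 : ℚ) < j := by exact_mod_cast hj
    have h1 : (j : ℚ) / b < j / (m * ν) := div_lt_div_of_pos_left hj' (by positivity) hb
    have h2 : (1 : ℚ) < i / ν + j / (m * ν) := by linarith
    have h3 : (i : ℚ) / ν + j / (m * ν) = (i + j / m) / ν := by field_simp
    rw [h3, lt_div_iff₀ hν', one_mul] at h2
    exact h2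

theorem lt_degree_of_ne {ν : ℕ} {b : ℚ} (hν : 0 < ν) (hb : (ν : ℚ) < b)
    {p : ℕ × ℕ} (hp : p ≠ (ν, 0)) (h : 1 ≤ (p.1 : ℚ) / ν + (p.2 : ℚ) / b) :
    ν + 1 ≤ p.1 + p.2 := by
  have := lt_weight_of_ne hν one_pos (by simpa using hb) hp h
  rw [Nat.cast_one, div_one] at this
  exact_mod_cast this

variable [IsLocalRing O] [IsNoetherianRing O]

theorem order_spec {f : O} (hf : f ≠ 0) :
    f ∈ maximalIdeal O ^ order f ∧ f ∉ maximalIdeal O ^ (order f + 1) := by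
  obtain ⟨N, hN⟩ : ∃ N : ℕ, f ∉ maximalIdeal O ^ N := by
    by_contra! hc
    refine hf ((Submodule.mem_bot O).mp (mem_of_forall_mem_sup_pow (I := ⊥) fun n => ?_))
    simpa using hc n
  have hb : BddAbove {n : ℕ | f ∈ maximalIdeal O ^ n} :=
    ⟨N, fun n hn => by
      by_contra! hlt
      exact hN (Ideal.pow_le_pow_right hlt.le hn)⟩
  refine ⟨Nat.sSup_mem ⟨0, by simp⟩ hb, fun h => ?_⟩
  have h1 : order f + 1 ≤ order f := le_csSup hb h
  omega

theorem order_eq {f : O} {n : ℕ} (h : f ∈ maximalIdeal O ^ n)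
    (h' : f ∉ maximalIdeal O ^ (n + 1)) : order f = n := by
  have hf : f ≠ 0 := fun e => h' (e ▸ Ideal.zero_mem _)
  obtain ⟨h1, h2⟩ := order_spec hf
  apply le_antisymm
  · by_contra! hlt
    exact h' (Ideal.pow_le_pow_right hlt h1)
  · by_contra! hlt
    exact h2 (Ideal.pow_le_pow_right hlt h)

theorem order_pos {f : O} (hf : f ≠ 0) (hm : f ∈ maximalIdeal O) : 0 < order f := by
  by_contra! h0
  have h := (order_spec hf).2
  rw [Nat.le_zero.mp h0, zero_add, pow_one] at h
  exact h hm

theorem order_eq_of_sub_mem {f g : O} (hf : f ≠ 0)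
    (h : f - g ∈ maximalIdeal O ^ (order f + 1)) : order g = order f := by
  obtain ⟨h1, h2⟩ := order_spec hf
  apply order_eq
  · have := Ideal.sub_mem _ h1 (Ideal.pow_le_pow_right (Nat.le_succ _) h)
    rwa [sub_sub_cancel] at this
  · intro hg
    have := Ideal.add_mem _ h hg
    rw [sub_add_cancel] at this
    exact h2 this

theorem initialFormIsPowerOf_of_sub_mem {f g y : O} (hf : f ≠ 0)
    (h : f - g ∈ maximalIdeal O ^ (order f + 1)) (hp : InitialFormIsPowerOf f y) :
    InitialFormIsPowerOf g y := by
  obtain ⟨u, hu, h1⟩ := hp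
  refine ⟨u, hu, ?_⟩
  rw [order_eq_of_sub_mem hf h]
  have := Ideal.sub_mem _ h1 h
  convert this using 1
  ring

/-- The supremum cannot approach 1 without reaching it: any exponent in a finite expansion of `g`
bounds the valuation by its own weight. -/
theorem isAdmissible_iff (hdim : ringKrullDim O = 2) {g x₁ x₂ : O} (hx : IsParameters x₁ x₂)
    {a₁ a₂ : ℚ} (ha₁ : 0 < a₁) (ha₂ : 0 < a₂) :
    IsAdmissible g x₁ x₂ a₁ a₂ ↔ g ∈ valuationIdeal x₁ x₂ a₁ a₂ 1 := by
  refine ⟨fun h => ?_, isAdmissible_of_mem⟩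
  obtain ⟨c, hc⟩ := hx.exists_isExpansion hdim g
  rw [valuationIdeal_eq]
  refine hc.mem_monomialIdeal fun p hp => ?_
  by_contra hlt
  replace hlt : (p.1 : ℚ) / a₁ + (p.2 : ℚ) / a₂ < 1 := not_le.mp hlt
  have hle : monomialValuation x₁ x₂ a₁ a₂ g ≤
      ((((p.1 : ℚ) / a₁ + (p.2 : ℚ) / a₂ : ℚ) : ℝ) : EReal) := by
    refine sSup_le ?_
    rintro _ ⟨t, ht, rfl⟩
    rw [valuationIdeal_eq] at ht
    obtain ⟨q, hq, hqp⟩ := hc.exists_le_of_mem hdim hx ht hp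
    rw [EReal.coe_le_coe_iff, Rat.cast_le]
    have hq' : t ≤ (q.1 : ℚ) / a₁ + (q.2 : ℚ) / a₂ := hq
    have h1 : (q.1 : ℚ) ≤ p.1 := by exact_mod_cast hqp.1
    have h2 : (q.2 : ℚ) ≤ p.2 := by exact_mod_cast hqp.2
    exact hq'.trans (by gcongr)
  have h1 := h.trans hle
  rw [← EReal.coe_one, EReal.coe_le_coe_iff] at h1
  have h2 : (1 : ℚ) ≤ (p.1 : ℚ) / a₁ + (p.2 : ℚ) / a₂ := by exact_mod_cast h1
  exact absurd h2 (not_le.mpr hlt)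

/-! ### Comparison of two systems of parameters -/

/-- For `b > ν`, the only monomial of value at least 1 and degree at most ν is `y₁ ^ ν`; the bound
on the order of `h` forces it to occur. -/
theorem exists_isUnit_sub_mem (hdim : ringKrullDim O = 2) {h y₁ y₂ : O} {ν : ℕ} {b : ℚ}
    (hν : 0 < ν) (hb : (ν : ℚ) < b) (hy : IsParameters y₁ y₂)
    (hord : h ∉ maximalIdeal O ^ (ν + 1)) (hm : h ∈ valuationIdeal y₁ y₂ ν b 1) :
    ∃ u : O, IsUnit u ∧ h - u * y₁ ^ ν ∈ monomialIdeal y₁ y₂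
      {p | p ≠ (ν, 0) ∧ 1 ≤ (p.1 : ℚ) / ν + (p.2 : ℚ) / b} := by
  obtain ⟨c, hc⟩ := hy.exists_isExpansion hdim h
  have hν' : (0 : ℚ) < ν := by exact_mod_cast hν
  have hw : ∀ p, c p ≠ 0 → 1 ≤ (p.1 : ℚ) / ν + (p.2 : ℚ) / b := fun p hp => by
    rw [valuationIdeal_eq] at hm
    obtain ⟨q, hq, hqp⟩ := hc.exists_le_of_mem hdim hy hm hp
    have h1 : (q.1 : ℚ) ≤ p.1 := by exact_mod_cast hqp.1
    have h2 : (q.2 : ℚ) ≤ p.2 := by exact_mod_cast hqp.2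
    have hb0 : 0 < b := hν'.trans hb
    exact le_trans hq (by gcongr)
  have h0 : c (ν, 0) ≠ 0 := fun h0 => hord <| by
    rw [hy.pow_maximalIdeal]
    exact hc.mem_monomialIdeal fun p hp =>
      lt_degree_of_ne hν hb (fun e => hp (by rw [e]; exact h0)) (hw p hp)
  refine ⟨c (ν, 0), (hc.1 _).resolve_left h0, ?_⟩
  have e : h - c (ν, 0) * y₁ ^ ν =
      ∑ q ∈ c.support.erase (ν, 0), c q * (y₁ ^ q.1 * y₂ ^ q.2) := by
    conv_lhs => rw [hc.2, Finsupp.sum, ← Finset.add_sum_erase _ _ (Finsupp.mem_support_iff.mpr h0)]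
    simp only [mul_assoc, pow_zero, mul_one, add_sub_cancel_left]
  rw [e]
  refine Ideal.sum_mem _ fun p hp => Ideal.mul_mem_left _ _ (monomial_mem ?_)
  rw [Finset.mem_erase, Finsupp.mem_support_iff] at hp
  exact ⟨hp.1, hw p hp.2⟩

theorem initialFormIsPowerOf_of_mem (hdim : ringKrullDim O = 2) {h y₁ y₂ : O} {b : ℚ} (h0 : h ≠ 0)
    (hm : h ∈ maximalIdeal O) (hb : (order h : ℚ) < b) (hy : IsParameters y₁ y₂)
    (hv : h ∈ valuationIdeal y₁ y₂ (order h) b 1) : InitialFormIsPowerOf h y₁ := by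
  obtain ⟨u, hu, hmem⟩ := exists_isUnit_sub_mem hdim (order_pos h0 hm) hb hy (order_spec h0).2 hv
  refine ⟨u, hu, ?_⟩
  rw [hy.pow_maximalIdeal]
  exact monomialIdeal_subset (fun p hp => lt_degree_of_ne (order_pos h0 hm) hb hp.1 hp.2) hmem

omit [IsNoetherianRing O] in
theorem mem_pow_of_mem_valuationIdeal {h y₁ y₂ : O} {n : ℕ} {b₁ b₂ : ℚ} (hy : IsParameters y₁ y₂)
    (hb₁ : (n : ℚ) < b₁) (hb : b₁ ≤ b₂) (hv : h ∈ valuationIdeal y₁ y₂ b₁ b₂ 1) :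
    h ∈ maximalIdeal O ^ (n + 1) := by
  rw [valuationIdeal_eq] at hv
  rw [hy.pow_maximalIdeal]
  refine monomialIdeal_subset (fun p (hp : (1 : ℚ) ≤ _) => ?_) hv
  have hn : (0 : ℚ) ≤ n := Nat.cast_nonneg n
  have hb₁' : 0 < b₁ := hn.trans_lt hb₁
  have h1 : (p.2 : ℚ) / b₂ ≤ p.2 / b₁ := by gcongr
  have h2 : 1 ≤ ((p.1 : ℚ) + p.2) / b₁ := by rw [add_div]; linarith
  rw [le_div_iff₀ hb₁', one_mul] at h2
  have h3 : (n : ℚ) < p.1 + p.2 := hb₁.trans_le h2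
  have h4 : n < p.1 + p.2 := by exact_mod_cast h3
  exact h4

/-- Write `y = a * z + b * x`. Were `a` not a unit, `y ^ ν` would lie in `(x) + 𝔪 ^ (ν + 1)`, and so
would a unit multiple of `z ^ ν`, which is impossible. -/
theorem IsParameters.of_initialFormIsPowerOf (hdim : ringKrullDim O = 2) {h x z y : O}
    (h0 : h ≠ 0) (hm : h ∈ maximalIdeal O) (hx : IsParameters x z) (hy : y ∈ maximalIdeal O)
    (hpz : InitialFormIsPowerOf h z) (hpy : InitialFormIsPowerOf h y) : IsParameters x y := by
  obtain ⟨a, b, e⟩ := hx.symm.exists_eq hy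
  refine hx.of_isUnit (a := a) (b := b) ?_ e
  by_contra ha
  have hν := order_pos h0 hm
  obtain ⟨u, hu, h1⟩ := hpz
  obtain ⟨v, -, h2⟩ := hpy
  generalize order h = ν at hν h1 h2
  have hz := hx.right_mem
  -- This is `(x) + 𝔪 ^ (ν + 1)`.
  let J := monomialIdeal z x ({p | ν + 1 ≤ p.1 + p.2} ∪ {(0, 1)})
  have hmJ : maximalIdeal O ^ (ν + 1) ≤ J := by
    rw [hx.symm.pow_maximalIdeal]
    exact monomialIdeal_subset Set.subset_union_left
  have hxJ : x ∈ J := by simpa using monomial_mem (x := z) (y := x) (p := (0, 1)) (Or.inr rfl)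
  have hyJ : y ^ ν ∈ J := by
    have h3 : (a * z) ^ ν ∈ J := by
      refine hmJ ?_
      rw [mul_pow]
      have : a ^ ν ∈ maximalIdeal O ^ 1 := by
        rw [pow_one]
        exact Ideal.pow_mem_of_mem _ ((mem_maximalIdeal a).mpr ha) _ hν
      rw [add_comm, pow_add]
      exact Ideal.mul_mem_mul this (Ideal.pow_mem_pow hz _)
    have h4 : y - a * z ∣ y ^ ν - (a * z) ^ ν := sub_dvd_pow_sub_pow _ _ _
    have h5 : y ^ ν - (a * z) ^ ν ∈ J := by
      refine Ideal.mem_of_dvd _ h4 ?_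
      rw [e, add_sub_cancel_left]
      exact Ideal.mul_mem_left _ _ hxJ
    have := Ideal.add_mem _ h5 h3
    rwa [sub_add_cancel] at this
  have hfin : u * (z ^ (ν, 0).1 * x ^ (ν, 0).2) ∈ J := by
    have := Ideal.add_mem _ (hmJ (Ideal.sub_mem _ h2 h1)) (Ideal.mul_mem_left _ v hyJ)
    convert this using 1
    simp
  obtain ⟨q, hq, hle⟩ := hx.symm.exists_le_of_mem hdim hu hfin
  have h1 := hle.1
  have h2 := hle.2
  dsimp only at h1 h2
  rcases hq with hq | hq
  · have : ν + 1 ≤ q.1 + q.2 := hq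
    omega
  · rw [Set.mem_singleton_iff.mp hq] at h2
    simp at h2

/-- As long as the coefficient of `x₂ ^ M` is not a unit, it can be absorbed into a multiple of `x₁`
and of `x₂ ^ (M + 1)`. The process stops at the first power of `x₂` by which `y` genuinely deviates
from `x₁`. -/
theorem exists_eq_of_isParameters (hdim : ringKrullDim O = 2) {x₁ x₂ y : O}
    (hx : IsParameters x₂ x₁) (hy : IsParameters x₂ y) (M : ℕ) (hM : 0 < M) :
    y ∈ Ideal.span {x₁, x₂ ^ M} ∨ ∃ (m : ℕ) (a b : O), 0 < m ∧ m < M ∧ IsUnit a ∧ IsUnit b ∧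
      y = a * x₁ + b * x₂ ^ m := by
  induction M, hM using Nat.le_induction with
  | base =>
    left
    have := hy.right_mem
    rw [hx.symm] at this
    simpa using this
  | succ M hM ih =>
    rcases ih with h | ⟨m, a, b, h1, h2, h⟩
    · rw [Ideal.mem_span_pair] at h
      obtain ⟨a, b, rfl⟩ := h
      have hM0 : M ≠ 0 := by omega
      by_cases hb : IsUnit b
      · right
        refine ⟨M, a, b, hM, Nat.lt_succ_self M, ?_, hb, rfl⟩
        by_contra ha
        -- With `a` in the maximal ideal, `x₁ = s * y + t * x₂` would give `x₁ ∈ (x₁ ^ 2, x₂)`.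
        obtain ⟨s, t, e⟩ := hy.symm.exists_eq hx.right_mem
        obtain ⟨k, rfl⟩ := Nat.exists_eq_succ_of_ne_zero hM0
        have ha' := (mem_maximalIdeal a).mpr ha
        obtain ⟨c, d, rfl⟩ := hx.symm.exists_eq ha'
        have hmem : (1 : O) * (x₁ ^ (1, 0).1 * x₂ ^ (1, 0).2) ∈
            Ideal.span {x₁ ^ ((1, 0) : ℕ × ℕ).1.succ, x₂ ^ ((1, 0) : ℕ × ℕ).2.succ} := by
          rw [Ideal.mem_span_pair]
          refine ⟨s * c, s * d * x₁ + s * b * x₂ ^ k + t, ?_⟩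
          simp only [Nat.succ_eq_add_one] at e ⊢
          linear_combination -e
        exact hx.symm.unit_mul_monomial_notMem hdim isUnit_one 1 0 hmem
      · left
        obtain ⟨c, d, rfl⟩ := hx.symm.exists_eq ((mem_maximalIdeal b).mpr hb)
        rw [Ideal.mem_span_pair]
        exact ⟨a + c * x₂ ^ M, d, by ring⟩
    · exact Or.inr ⟨m, a, b, h1, by omega, h⟩

/-- If the value of `y` were too small, `y = a * x₁ + β * x₂ ^ m` with units `a`, `β` and `m * ν <
b`. Substituting for `x₁` in the leading term `u * x₁ ^ ν` of `h` produces `x₂ ^ (m * ν)` with unit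
coefficient in the coordinates `(y, x₂)`, a monomial of value less than 1. This makes the center
unique. -/
theorem IsParameters.mem_valuationIdeal_of_mem (hdim : ringKrullDim O = 2) {h x₁ x₂ y : O} {ν : ℕ}
    {b : ℚ} (hν : 0 < ν) (hb : (ν : ℚ) < b) (hx : IsParameters x₂ x₁) (hy : IsParameters x₂ y)
    (hord : h ∉ maximalIdeal O ^ (ν + 1)) (h₁ : h ∈ valuationIdeal x₁ x₂ ν b 1)
    (h₂ : h ∈ valuationIdeal y x₂ ν b 1) : y ∈ valuationIdeal x₁ x₂ ν b (1 / ν) := by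
  have hν' : (0 : ℚ) < ν := by exact_mod_cast hν
  have hb0 : 0 < b := hν'.trans hb
  -- The ceiling of `b / ν` is the least exponent `M` for which `x₂ ^ M` has value at least `1 / ν`.
  rcases exists_eq_of_isParameters hdim hx hy ⌈b / ν⌉₊ (Nat.ceil_pos.mpr (by positivity)) with
    hmem | ⟨m, a, β, hm, hlt, ha, hβ, e⟩
  · rw [Ideal.mem_span_pair] at hmem
    obtain ⟨s, t, rfl⟩ := hmem
    refine Ideal.add_mem _ (Ideal.mul_mem_left _ _ (left_mem_valuationIdeal _ _ _ _))
      (Ideal.mul_mem_left _ _ ?_)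
    have : (1 : ℚ) / ν ≤ (0 : ℕ) / ν + (⌈b / ν⌉₊ : ℚ) / b := by
      rw [Nat.cast_zero, zero_div, zero_add, le_div_iff₀ hb0, one_div_mul_eq_div]
      exact Nat.le_ceil _
    simpa using monomial_mem_valuationIdeal (x₁ := x₁) (x₂ := x₂) this
  · exfalso
    have hm' : (0 : ℚ) < m := by exact_mod_cast hm
    have hmb : (m : ℚ) * ν < b := by
      rw [← lt_div_iff₀ hν']
      exact Nat.lt_ceil.mp hlt
    obtain ⟨u, hu, h3⟩ := exists_isUnit_sub_mem hdim hν hb hx.symm hord h₁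
    -- The three pieces absorb the multiples of `y`, the part of `h` beyond `u * x₁ ^ ν` (for the
    -- weights `1` and `1 / m`), and `h` itself. None of their monomials divides `x₂ ^ (m * ν)`.
    let J := monomialIdeal y x₂ ({p | 0 < p.1} ∪ {p | (ν : ℚ) < (p.1 : ℚ) / 1 + (p.2 : ℚ) / m} ∪
      {p | 1 ≤ (p.1 : ℚ) / ν + (p.2 : ℚ) / b})
    have hyJ : y ∈ J := by
      have : y ^ (1, 0).1 * x₂ ^ (1, 0).2 ∈ J := monomial_mem (Or.inl (Or.inl Nat.one_pos))
      rwa [pow_one, pow_zero, mul_one] at this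
    have hhJ : h ∈ J := by
      rw [valuationIdeal_eq] at h₂
      exact monomialIdeal_subset Set.subset_union_right h₂
    have hpow : x₂ ^ m ∈ valuationIdeal y x₂ 1 m (1 / 1) := by
      simpa using monomial_mem_valuationIdeal (x₁ := y) (x₂ := x₂) (a₁ := 1) (a₂ := m)
        (t := 1 / 1) (i := 0) (j := m) (by rw [div_self hm'.ne']; simp)
    have hx₁ : x₁ ∈ valuationIdeal y x₂ 1 m (1 / 1) := by
      obtain ⟨v, rfl⟩ := ha
      have : x₁ = ↑v⁻¹ * y - ↑v⁻¹ * β * x₂ ^ m := by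
        rw [e]; linear_combination -x₁ * v.inv_mul
      rw [this]
      exact Ideal.sub_mem _ (Ideal.mul_mem_left _ _ (left_mem_valuationIdeal _ _ _ _))
        (Ideal.mul_mem_left _ _ hpow)
    have h4 : h - u * x₁ ^ ν ∈ J := by
      have h5 : h - u * x₁ ^ ν ∈
          monomialIdeal x₁ x₂ {p | (ν : ℚ) < (p.1 : ℚ) / 1 + (p.2 : ℚ) / m} :=
        monomialIdeal_subset (fun p hp => by
          have := lt_weight_of_ne hν hm hmb hp.1 hp.2
          simpa using this) h3
      exact monomialIdeal_subset (fun p hp => Or.inl (Or.inr hp))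
        (monomialIdeal_lt_le hx₁ (right_mem_valuationIdeal _ _ _ _) _ h5)
    have h5 : u * x₁ ^ ν ∈ J := by
      have := Ideal.sub_mem _ hhJ h4
      rwa [sub_sub_cancel] at this
    have h6 : u * (-β * x₂ ^ m) ^ ν ∈ J := by
      have hd : a * x₁ - (-β * x₂ ^ m) ∣ (a * x₁) ^ ν - (-β * x₂ ^ m) ^ ν :=
        sub_dvd_pow_sub_pow _ _ _
      have hd' : (a * x₁) ^ ν - (-β * x₂ ^ m) ^ ν ∈ J := by
        refine Ideal.mem_of_dvd _ hd ?_
        convert hyJ using 1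
        rw [e]; ring
      have := Ideal.sub_mem _ (Ideal.mul_mem_left _ (a ^ ν) h5) (Ideal.mul_mem_left _ u hd')
      convert this using 1
      rw [mul_pow a]; ring
    have h7 : (u * (-β) ^ ν) * (y ^ (0, m * ν).1 * x₂ ^ (0, m * ν).2) ∈ J := by
      convert h6 using 1
      simp only [pow_zero, one_mul]
      rw [mul_pow (-β), pow_mul]; ring
    obtain ⟨q, hq, hle⟩ := hy.symm.exists_le_of_mem hdim (hu.mul (hβ.neg.pow ν)) h7
    have hq1 : q.1 = 0 := Nat.le_zero.mp hle.1
    have hq2 : (q.2 : ℚ) ≤ m * ν := by exact_mod_cast hle.2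
    rcases hq with (hq | hq) | hq
    · exact absurd hq1 (Nat.pos_iff_ne_zero.mp hq)
    · have hq' : (ν : ℚ) < (q.1 : ℚ) / 1 + (q.2 : ℚ) / m := hq
      rw [hq1, Nat.cast_zero, zero_div, zero_add, lt_div_iff₀ hm'] at hq'
      linarith
    · have hq' : 1 ≤ (q.1 : ℚ) / ν + (q.2 : ℚ) / b := hq
      rw [hq1, Nat.cast_zero, zero_div, zero_add, le_div_iff₀ hb0] at hq'
      linarith

end PlaneCurve

namespace PlaneCurve

variable {O : Type*} [CommRing O]

/-! ### The projected polyhedron through monomial ideals -/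

section Polyhedron

variable [IsLocalRing O] [IsNoetherianRing O]

/-- The half-lines already form an upper set of `ℝ`, so taking the convex hull changes nothing. What
remains is whether some monomial lies on or below the line of slope `r` through `z ^ ν`, which a
monomial ideal detects. Exponents are listed here with `z` first. -/
theorem mem_projectedPolyhedron_iff (hdim : ringKrullDim O = 2) {f x z : O}
    (h : IsParameters x z) {r : ℝ} : r ∈ projectedPolyhedron f x z ↔
      f ∉ monomialIdeal z x
        {p | order f ≤ p.1 ∨ r * ((order f : ℝ) - (p.1 : ℝ)) < (p.2 : ℝ)} := by
  have hup : IsUpperSet {r : ℝ | ∃ (c : ℕ × ℕ →₀ O) (A b : ℕ), IsExpansion f x z c ∧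
      c (A, b) ≠ 0 ∧ b < order f ∧ (A : ℝ) / ((order f : ℝ) - (b : ℝ)) ≤ r} := by
    rintro s t hst ⟨c, A, b, h1, h2, h3, h4⟩
    exact ⟨c, A, b, h1, h2, h3, h4.trans hst⟩
  rw [projectedPolyhedron, hup.ordConnected.convex.convexHull_eq, monomialIdeal_swap]
  constructor
  · rintro ⟨c, A, b, hc, h0, hb, hr⟩ hmem
    obtain ⟨q, hq, hle⟩ := hc.exists_le_of_mem hdim h hmem h0
    have hb' : (b : ℝ) < order f := by exact_mod_cast hb
    have h1 : (q.1 : ℝ) ≤ A := by exact_mod_cast hle.1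
    have h2 : (q.2 : ℝ) ≤ b := by exact_mod_cast hle.2
    have hpos : 0 < (order f : ℝ) - b := sub_pos.mpr hb'
    have hr0 : 0 ≤ r := le_trans (by positivity) hr
    rcases hq with hq | hq
    · exact absurd (le_trans hq hle.2) (not_le.mpr hb)
    · have hq' : r * ((order f : ℝ) - q.2) < q.1 := hq
      rw [div_le_iff₀ hpos] at hr
      have : r * ((order f : ℝ) - b) ≤ r * ((order f : ℝ) - q.2) := by gcongr
      linarith
  · intro hmem
    obtain ⟨c, hc⟩ := h.exists_isExpansion hdim f
    by_contra hno
    refine hmem (hc.mem_monomialIdeal fun p hp => ?_)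
    change order f ≤ p.2 ∨ r * ((order f : ℝ) - p.2) < p.1
    by_contra! hbad
    have hpos : (0 : ℝ) < (order f : ℝ) - p.2 := sub_pos.mpr (by exact_mod_cast hbad.1)
    exact hno ⟨c, p.1, p.2, hc, hp, hbad.1, (div_le_iff₀ hpos).mpr hbad.2⟩

theorem le_of_mem_projectedPolyhedron (hdim : ringKrullDim O = 2) {f x z : O}
    (h : IsParameters x z) {δ : ℚ} (hδ : 0 < δ)
    (hf : f ∈ valuationIdeal z x (order f) (order f * δ) 1) {r : ℝ}
    (hr : r ∈ projectedPolyhedron f x z) : (δ : ℝ) ≤ r := by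
  by_contra! hlt
  rw [mem_projectedPolyhedron_iff hdim h] at hr
  refine hr ?_
  rw [valuationIdeal_eq] at hf
  refine monomialIdeal_subset (fun p (hp : (1 : ℚ) ≤ _) => ?_) hf
  by_cases hν : order f ≤ p.1
  · exact Or.inl hν
  · right
    have hlt' : p.1 < order f := not_le.mp hν
    have hν0 : (0 : ℚ) < order f := by exact_mod_cast (Nat.zero_le _).trans_lt hlt'
    have hδ' : (order f : ℚ) * δ ≠ 0 := by positivity
    have h1 : δ * ((order f : ℚ) - p.1) ≤ p.2 := by
      have e : (p.1 : ℚ) / order f + p.2 / (order f * δ) = (p.1 * δ + p.2) / (order f * δ) := by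
        field_simp
      rw [e, le_div_iff₀ (by positivity)] at hp
      linarith
    have h2 : (δ : ℝ) * ((order f : ℝ) - p.1) ≤ p.2 := by exact_mod_cast h1
    have h3 : (0 : ℝ) < (order f : ℝ) - p.1 := sub_pos.mpr (by exact_mod_cast hlt')
    exact (mul_lt_mul_of_pos_right hlt h3).trans_le h2

omit [IsNoetherianRing O] in
theorem polyhedronDelta_eq {f x z : O} {δ : ℝ} (h : δ ∈ projectedPolyhedron f x z)
    (h' : ∀ r ∈ projectedPolyhedron f x z, δ ≤ r) : polyhedronDelta f x z = (δ : EReal) := by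
  apply le_antisymm
  · exact sInf_le ⟨δ, h, rfl⟩
  · refine le_sInf ?_
    rintro _ ⟨r, hr, rfl⟩
    exact EReal.coe_le_coe_iff.mpr (h' r hr)

end Polyhedron

/-! ### Curves with regular reduction -/

section Regular

variable [IsLocalRing O] [IsNoetherianRing O]

omit [IsNoetherianRing O] in
theorem IsParameters.exists_of_notMem_sq {x y p : O} (h : IsParameters x y)
    (hp : p ∈ maximalIdeal O) (hp2 : p ∉ maximalIdeal O ^ 2) : ∃ w, IsParameters w p := by
  obtain ⟨a, b, e⟩ := h.exists_eq hp
  by_cases hb : IsUnit b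
  · exact ⟨x, h.of_isUnit hb (by rw [e]; ring)⟩
  by_cases ha : IsUnit a
  · exact ⟨y, h.symm.of_isUnit ha e⟩
  refine absurd ?_ hp2
  rw [e, pow_two]
  exact Ideal.add_mem _ (Ideal.mul_mem_mul ((mem_maximalIdeal a).mpr ha) h.left_mem)
    (Ideal.mul_mem_mul ((mem_maximalIdeal b).mpr hb) h.right_mem)

theorem isPrincipal_maximalIdeal_of_ringKrullDim_le_one {R : Type*} [CommRing R]
    [hR : IsRegularLocalRing R] (h : ringKrullDim R ≤ 1) :
    ∃ a : R, maximalIdeal R = Ideal.span {a} := by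
  have h1 := hR.spanFinrank_maximalIdeal
  rw [← h1] at h
  have h2 : (maximalIdeal R).spanFinrank ≤ 1 := by exact_mod_cast h
  rcases Nat.le_one_iff_eq_zero_or_eq_one.mp h2 with h3 | h3
  · rw [Submodule.spanFinrank_eq_zero_iff_eq_bot (IsNoetherian.noetherian _)] at h3
    exact ⟨0, by rw [h3]; simp⟩
  · rw [Submodule.spanFinrank_eq_one_iff] at h3
    exact h3.1.principal

/-- The quotient by `P = √(g)` is regular of dimension at most 1, so `𝔪 = (a) + P` for some `a`. If
`P ≤ 𝔪 ^ 2`, Nakayama would make `𝔪` principal. So `P` contains a parameter `z`; it is prime, and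
`g` divides a power of it. -/
theorem exists_eq_unit_mul_pow_of_isRegular (hdim : ringKrullDim O = 2) {x y g : O}
    (h : IsParameters x y) (hg0 : g ≠ 0) (hg : g ∈ maximalIdeal O)
    (hreg : IsRegularLocalRing (O ⧸ (Ideal.span {g}).radical)) :
    ∃ (w z u : O) (k : ℕ), IsParameters w z ∧ IsUnit u ∧ 0 < k ∧ g = u * z ^ k := by
  have hdom := h.isDomain hdim
  set P := (Ideal.span {g}).radical with hP
  have hle : Ideal.span {g} ≤ P := Ideal.le_radical
  have hd1 : ringKrullDim (O ⧸ P) ≤ ringKrullDim (O ⧸ Ideal.span {g}) :=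
    ringKrullDim_le_of_surjective (Ideal.Quotient.factor hle) (Ideal.Quotient.factor_surjective hle)
  have hd2 := ringKrullDim_quotient_succ_le_of_nonZeroDivisor (mem_nonZeroDivisors_of_ne_zero hg0)
  rw [hdim] at hd2
  have hd : ringKrullDim (O ⧸ P) ≤ 1 := by
    have h3 : ringKrullDim (O ⧸ P) + 1 ≤ 1 + 1 := by
      rw [one_add_one_eq_two]
      exact le_trans (by gcongr) hd2
    exact ENat.WithBot.add_le_add_one_right_iff.mp h3
  obtain ⟨a, ha⟩ := isPrincipal_maximalIdeal_of_ringKrullDim_le_one hd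
  obtain ⟨a, rfl⟩ := Ideal.Quotient.mk_surjective a
  have hPm : P ≤ maximalIdeal O := by
    refine (Ideal.radical_mono (?_ : Ideal.span {g} ≤ maximalIdeal O)).trans
      (maximalIdeal.isMaximal O).isPrime.radical.le
    simpa [Ideal.span_le] using hg
  have hsurj : Function.Surjective (Ideal.Quotient.mk P) := Ideal.Quotient.mk_surjective
  have hcomap : ∀ b : O, b ∈ maximalIdeal O ↔ Ideal.Quotient.mk P b ∈ maximalIdeal (O ⧸ P) := by
    have : IsLocalHom (Ideal.Quotient.mk P) := IsLocalHom.of_surjective _ hsurj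
    intro b
    simp [mem_maximalIdeal, mem_nonunits_iff]
  have hgen : maximalIdeal O ≤ Ideal.span {a} ⊔ P := fun b hb => by
    rw [hcomap, ha, Ideal.mem_span_singleton'] at hb
    obtain ⟨c, hc⟩ := hb
    obtain ⟨c, rfl⟩ := hsurj c
    rw [← map_mul, eq_comm, Ideal.Quotient.mk_eq_mk_iff_sub_mem] at hc
    have := Ideal.add_mem _ (Ideal.mem_sup_right (S := Ideal.span {a}) hc)
      (Ideal.mem_sup_left (T := P) (Ideal.mul_mem_left _ c (Ideal.mem_span_singleton_self a)))
    rwa [sub_add_cancel] at this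
  have ham : a ∈ maximalIdeal O := by
    rw [hcomap, ha]; exact Ideal.mem_span_singleton_self _
  obtain ⟨z, hzP, hz2⟩ : ∃ z ∈ P, z ∉ maximalIdeal O ^ 2 := by
    by_contra! hc
    refine maximalIdeal_ne_span_singleton hdim a (eq_of_le_sup_maximalIdeal_smul
      (by simpa [Ideal.span_le] using ham) (hgen.trans (sup_le_sup_left ?_ _)))
    intro b hb
    rw [smul_eq_mul, ← pow_two]
    exact hc b hb
  obtain ⟨w, hw⟩ := h.exists_of_notMem_sq (hPm hzP) hz2
  have hz0 : z ≠ 0 := fun e => hz2 (e ▸ Ideal.zero_mem _)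
  have hzp : Prime z := (Ideal.span_singleton_prime hz0).mp (hw.symm.isPrime_span hdim)
  obtain ⟨n, hn⟩ := hzP
  rw [Ideal.mem_span_singleton, dvd_prime_pow hzp] at hn
  obtain ⟨k, -, u, hu⟩ := hn
  refine ⟨w, z, ↑u⁻¹, k, hw, u⁻¹.isUnit, ?_, ?_⟩
  · by_contra! hk
    rw [Nat.le_zero.mp hk, pow_zero] at hu
    exact (mem_maximalIdeal g).mp hg (IsUnit.of_mul_eq_one _ hu)
  · rw [← hu, mul_comm g, Units.inv_mul_cancel_left]

theorem isRegularLocalRing_quotient_radical (hdim : ringKrullDim O = 2) {w z u : O} {k : ℕ}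
    (h : IsParameters w z) (hu : IsUnit u) (hk : 0 < k) :
    IsRegularLocalRing (O ⧸ (Ideal.span {u * z ^ k}).radical) := by
  have hdom := h.isDomain hdim
  have hprime := h.symm.isPrime_span hdim
  have hz0 : z ≠ 0 := fun e => by
    have h1 := maximalIdeal_ne_span_singleton hdim w
    rw [h, e] at h1
    exact h1 (by simp [Ideal.span_insert])
  rw [Ideal.span_singleton_mul_left_unit hu, ← Ideal.span_singleton_pow,
    Ideal.radical_pow _ hk.ne', hprime.radical]
  have hdim1 : ringKrullDim (O ⧸ Ideal.span {z}) = 1 := by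
    have := ringKrullDim_quotient_span_singleton_succ_eq_ringKrullDim_of_mem_nonZeroDivisors
      (mem_nonZeroDivisors_of_ne_zero hz0) h.right_mem
    rw [hdim, ← one_add_one_eq_two] at this
    exact ENat.WithBot.add_one_cancel.mp this
  have hnt : Nontrivial (O ⧸ Ideal.span {z}) := Ideal.Quotient.nontrivial_iff.mpr hprime.ne_top
  have hloc : IsLocalRing (O ⧸ Ideal.span {z}) :=
    IsLocalRing.of_surjective' (Ideal.Quotient.mk _) Ideal.Quotient.mk_surjective
  refine IsRegularLocalRing.of_spanFinrank_maximalIdeal_le _ ?_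
  have hmax : maximalIdeal (O ⧸ Ideal.span {z}) = Ideal.span {Ideal.Quotient.mk _ w} := by
    rw [← IsLocalRing.map_maximalIdeal_of_surjective (Ideal.Quotient.mk (Ideal.span {z}))
      Ideal.Quotient.mk_surjective, h, Ideal.map_span, Set.image_pair,
      Ideal.Quotient.eq_zero_iff_mem.mpr (Ideal.mem_span_singleton_self z)]
    simp [Ideal.span_insert]
  rw [hdim1, hmax]
  have := Submodule.spanFinrank_span_le_ncard_of_finite (R := O ⧸ Ideal.span {z})
    (Set.finite_singleton (Ideal.Quotient.mk (Ideal.span {z}) w))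
  rw [Set.ncard_singleton] at this
  exact_mod_cast this

theorem order_unit_mul_pow (hdim : ringKrullDim O = 2) {w z u : O} (k : ℕ)
    (h : IsParameters w z) (hu : IsUnit u) : order (u * z ^ k) = k := by
  refine order_eq (Ideal.mul_mem_left _ _ (Ideal.pow_mem_pow h.right_mem _)) fun hmem => ?_
  rw [h.symm.pow_maximalIdeal] at hmem
  obtain ⟨q, hq, hle⟩ := h.symm.exists_le_of_mem hdim hu (p := (k, 0)) (by simpa using hmem)
  have h1 : k + 1 ≤ q.1 + q.2 := hq
  have h2 := hle.1
  have h3 := hle.2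
  dsimp only at h2 h3
  omega

end Regular

/-! ### Existence and rationality of the slope -/

section Slope

variable [IsLocalRing O] [IsNoetherianRing O]

/-- The slope is the minimum of `p.2 / (ν - p.1)` over one finite expansion. It exceeds 1 since, the
initial form being a power of that of `z`, monomials with `p.1 < ν` have degree at least `ν + 1`. -/
theorem HasSingularReduction.exists_slope (hdim : ringKrullDim O = 2) {h x z : O}
    (hh : HasSingularReduction h) (hx : IsParameters x z) (hp : InitialFormIsPowerOf h z) :
    ∃ δ : ℚ, 1 < δ ∧ (δ : ℝ) ∈ projectedPolyhedron h x z ∧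
      h ∈ valuationIdeal z x (order h) (order h * δ) 1 := by
  obtain ⟨h0, hm, hsing⟩ := hh
  have hν := order_pos h0 hm
  have hord := (order_spec h0).2
  obtain ⟨u, hu, hmem⟩ := hp
  simp_rw [mem_projectedPolyhedron_iff hdim hx]
  generalize order h = ν at *
  have hν' : (0 : ℚ) < ν := by exact_mod_cast hν
  obtain ⟨c, hc⟩ := hx.symm.exists_isExpansion hdim h
  have hdeg : ∀ p, c p ≠ 0 → p.1 < ν → ν + 1 ≤ p.1 + p.2 := fun p hp hlt => by
    have h1 : h ∈ monomialIdeal z x ({p | ν + 1 ≤ p.1 + p.2} ∪ {p | ν ≤ p.1}) := by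
      have h2 : h - u * z ^ ν ∈ monomialIdeal z x ({p | ν + 1 ≤ p.1 + p.2} ∪ {p | ν ≤ p.1}) := by
        rw [hx.symm.pow_maximalIdeal] at hmem
        exact monomialIdeal_subset Set.subset_union_left hmem
      have h3 : z ^ ν * x ^ 0 ∈ monomialIdeal z x ({p | ν + 1 ≤ p.1 + p.2} ∪ {p | ν ≤ p.1}) :=
        monomial_mem (p := (ν, 0)) (Or.inr (le_refl ν))
      have := Ideal.add_mem _ h2 (Ideal.mul_mem_left _ u h3)
      convert this using 1
      ring
    obtain ⟨q, hq, hle⟩ := hc.exists_le_of_mem hdim hx.symm h1 hp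
    have h2 := hle.1
    have h3 := hle.2
    rcases hq with hq | hq
    · have hq' : ν + 1 ≤ q.1 + q.2 := hq
      omega
    · have hq' : ν ≤ q.1 := hq
      omega
  -- If no exponent had `p.1 < ν`, then `h = v * z ^ ν`, where the order forces `v` to be a unit:
  -- the reduction would be regular.
  have hne : (c.support.filter fun p => p.1 < ν).Nonempty := by
    by_contra hemp
    rw [Finset.not_nonempty_iff_eq_empty, Finset.filter_eq_empty_iff] at hemp
    have h1 : h ∈ Ideal.span {z ^ ν} := by
      refine monomialIdeal_le (S := {p | ν ≤ p.1}) (fun p (hp : ν ≤ p.1) => ?_)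
        (hc.mem_monomialIdeal (x := z) (y := x) fun p hp =>
          not_lt.mp (hemp (Finsupp.mem_support_iff.mpr hp)))
      exact Ideal.mul_mem_right _ _ (Ideal.mem_span_singleton.mpr (pow_dvd_pow z hp))
    obtain ⟨v, rfl⟩ := Ideal.mem_span_singleton'.mp h1
    by_cases hv : IsUnit v
    · exact hsing (isRegularLocalRing_quotient_radical hdim hx hv hν)
    · refine hord ?_
      rw [pow_succ']
      exact Ideal.mul_mem_mul ((mem_maximalIdeal v).mpr hv) (Ideal.pow_mem_pow hx.right_mem _)
  obtain ⟨p, hp, hmin⟩ := Finset.exists_min_image _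
    (fun p : ℕ × ℕ => (p.2 : ℚ) / ((ν : ℚ) - p.1)) hne
  simp only [Finset.mem_filter, Finsupp.mem_support_iff] at hp hmin
  obtain ⟨hp0, hpν⟩ := hp
  have hpν' : (p.1 : ℚ) < ν := by exact_mod_cast hpν
  have hpos : 0 < (ν : ℚ) - p.1 := sub_pos.mpr hpν'
  set δ : ℚ := (p.2 : ℚ) / ((ν : ℚ) - p.1) with hδ
  have hδp : δ * ((ν : ℚ) - p.1) = p.2 := div_mul_cancel₀ _ hpos.ne'
  have hδ1 : 1 < δ := by
    rw [hδ, one_lt_div hpos]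
    have := hdeg p hp0 hpν
    have h2 : (ν : ℚ) + 1 ≤ p.1 + p.2 := by exact_mod_cast this
    linarith
  refine ⟨δ, hδ1, fun hmem' => ?_, ?_⟩
  · obtain ⟨q, hq, hle⟩ := hc.exists_le_of_mem hdim hx.symm hmem' hp0
    have h2 := hle.1
    have h3 := hle.2
    rcases hq with hq | hq
    · have hq' : ν ≤ q.1 := hq
      omega
    · have hq' : δ * ((ν : ℚ) - q.1) < q.2 := by
        have : (δ : ℝ) * ((ν : ℝ) - q.1) < q.2 := hq
        exact_mod_cast this
      have h2' : (q.1 : ℚ) ≤ p.1 := by exact_mod_cast h2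
      have h3' : (q.2 : ℚ) ≤ p.2 := by exact_mod_cast h3
      nlinarith
  · rw [valuationIdeal_eq]
    refine hc.mem_monomialIdeal fun q hq => ?_
    change (1 : ℚ) ≤ q.1 / ν + q.2 / (ν * δ)
    have hδ0 : 0 < δ := zero_lt_one.trans hδ1
    by_cases hqν : q.1 < ν
    · have h1 := hmin q ⟨hq, hqν⟩
      have hq' : (q.1 : ℚ) < ν := by exact_mod_cast hqν
      rw [le_div_iff₀ (sub_pos.mpr hq')] at h1
      have e : (q.1 : ℚ) / ν + q.2 / (ν * δ) = (q.1 * δ + q.2) / (ν * δ) := by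
        field_simp
      rw [e, le_div_iff₀ (by positivity)]
      linarith
    · have hq' : (ν : ℚ) ≤ q.1 := by exact_mod_cast not_lt.mp hqν
      have h1 : (1 : ℚ) ≤ q.1 / ν := (one_le_div hν').mpr hq'
      have h2 : (0 : ℚ) ≤ q.2 / (ν * δ) := by positivity
      linarith

end Slope

end PlaneCurve

/-! ### Invariant and center by maximality -/

namespace PlaneCurve

variable {O : Type*} [CommRing O] [IsLocalRing O]

omit [IsLocalRing O] in
theorem valuationIdeal_congr {x₁ x₂ y₁ y₂ : O} {a₁ a₂ : ℚ}
    (h₁ : y₁ ∈ valuationIdeal x₁ x₂ a₁ a₂ (1 / a₁)) (h₂ : y₂ ∈ valuationIdeal x₁ x₂ a₁ a₂ (1 / a₂))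
    (h₃ : x₁ ∈ valuationIdeal y₁ y₂ a₁ a₂ (1 / a₁)) (h₄ : x₂ ∈ valuationIdeal y₁ y₂ a₁ a₂ (1 / a₂))
    (t : ℚ) : valuationIdeal y₁ y₂ a₁ a₂ t = valuationIdeal x₁ x₂ a₁ a₂ t :=
  le_antisymm (valuationIdeal_le_valuationIdeal h₁ h₂ t) (valuationIdeal_le_valuationIdeal h₃ h₄ t)

theorem IsParameters.mem_valuationIdeal {x₁ x₂ y : O} {a₁ a₂ : ℚ} (hx : IsParameters x₁ x₂)
    (hy : y ∈ maximalIdeal O) (ha₁ : 0 < a₁) (ha : a₁ ≤ a₂) :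
    y ∈ valuationIdeal x₁ x₂ a₁ a₂ (1 / a₂) := by
  obtain ⟨s, t, rfl⟩ := hx.exists_eq hy
  exact Ideal.add_mem _ (Ideal.mul_mem_left _ _ (valuationIdeal_anti _ _ _ _
    (one_div_le_one_div_of_le ha₁ ha) (left_mem_valuationIdeal _ _ _ _)))
    (Ideal.mul_mem_left _ _ (right_mem_valuationIdeal _ _ _ _))

/-- The valuation ideals do not depend on the choice of the parameter of smaller value. -/
theorem valuationIdeal_congr_right {x₁ x₂ y₂ : O} {a₁ a₂ : ℚ} (hx : IsParameters x₁ x₂)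
    (hy : IsParameters x₁ y₂) (ha₁ : 0 < a₁) (ha : a₁ ≤ a₂) (t : ℚ) :
    valuationIdeal x₁ y₂ a₁ a₂ t = valuationIdeal x₁ x₂ a₁ a₂ t :=
  valuationIdeal_congr (left_mem_valuationIdeal _ _ _ _)
    (hx.mem_valuationIdeal hy.right_mem ha₁ ha) (left_mem_valuationIdeal _ _ _ _)
    (hy.mem_valuationIdeal hx.right_mem ha₁ ha) t

/-- `δ` is the slope read off from the parameters `(x, z)`: the infimum of the projected polyhedron
if the initial form of `h` is a power, and `1` otherwise. -/
structure IsSlope (h x z : O) (δ : ℚ) : Prop where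
  mem : h ∈ valuationIdeal z x (order h) (order h * δ) 1
  one_lt : InitialFormIsPower h → 1 < δ
  mem_polyhedron : InitialFormIsPower h → (δ : ℝ) ∈ projectedPolyhedron h x z
  eq_one : ¬ InitialFormIsPower h → δ = 1

theorem IsSlope.one_le {h x z : O} {δ : ℚ} (hs : IsSlope h x z δ) : 1 ≤ δ := by
  by_cases hP : InitialFormIsPower h
  · exact (hs.one_lt hP).le
  · exact (hs.eq_one hP).ge

variable [IsNoetherianRing O] (hdim : ringKrullDim O = 2)

include hdim

omit hdim in
theorem IsParameters.mem_valuationIdeal_one {x z f : O} (hx : IsParameters x z) (hf : f ≠ 0)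
    (hm : f ∈ maximalIdeal O) : f ∈ valuationIdeal z x (order f) (order f) 1 := by
  have hν : (0 : ℚ) < order f := by exact_mod_cast order_pos hf hm
  have h1 := (order_spec hf).1
  rw [hx.symm.pow_maximalIdeal] at h1
  rw [valuationIdeal_eq]
  refine monomialIdeal_subset (fun p (hp : order f ≤ p.1 + p.2) => ?_) h1
  change (1 : ℚ) ≤ p.1 / order f + p.2 / order f
  rw [← add_div, one_le_div hν]
  exact_mod_cast hp

theorem IsCharacteristic.exists_isSlope {h x z : O} (hh : HasSingularReduction h)
    (hx : IsCharacteristic h x z) : ∃ δ : ℚ, IsSlope h x z δ := by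
  by_cases hP : InitialFormIsPower h
  · obtain ⟨δ, h1, h2, h3⟩ := hh.exists_slope hdim hx.1 (hx.2 hP).1
    exact ⟨δ, h3, fun _ => h1, fun _ => h2, fun h => absurd hP h⟩
  · exact ⟨1, by simpa using hx.1.mem_valuationIdeal_one hh.1 hh.2.1, fun h => absurd h hP,
      fun h => absurd h hP, fun _ => rfl⟩

theorem IsSlope.delta_eq {h x z : O} {δ : ℚ} (hs : IsSlope h x z δ) (hx : IsParameters x z) :
    delta h x z = ((δ : ℝ) : EReal) := by
  rw [delta]
  split_ifs with hP
  · exact polyhedronDelta_eq (hs.mem_polyhedron hP) fun r hr =>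
      le_of_mem_projectedPolyhedron hdim hx (zero_lt_one.trans (hs.one_lt hP)) hs.mem hr
  · rw [hs.eq_one hP]; simp

/-- The order bounds `b₁`; for `b₁ = ν < b₂`, the minimal polyhedron bounds `b₂`, because δ lies in
`Δ(h; x₂; y₁)`. -/
theorem IsSlope.isUniqueMaximalCenter {h x₁ x₂ : O} {δ : ℚ} (hs : IsSlope h x₂ x₁ δ)
    (hh : HasSingularReduction h) (hx : IsCharacteristic h x₂ x₁) :
    IsUniqueMaximalCenter h x₁ x₂ (order h) (order h * δ) := by
  obtain ⟨h0, hm, -⟩ := hh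
  have hν := order_pos h0 hm
  have hν' : (0 : ℚ) < order h := by exact_mod_cast hν
  refine ⟨isAdmissible_of_mem hs.mem, fun y₁ y₂ b₁ b₂ hy hb₁ hb hadm => ?_⟩
  rw [isAdmissible_iff hdim hy hb₁ (hb₁.trans_le hb)] at hadm
  have hb₁ν : b₁ ≤ order h := by
    by_contra! hlt
    exact (order_spec h0).2 (mem_pow_of_mem_valuationIdeal hy hlt hb hadm)
  rcases hb₁ν.lt_or_eq with hlt | rfl
  · exact ⟨Prod.Lex.toLex_le_toLex.mpr (Or.inl hlt), fun e => absurd e hlt.ne⟩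
  rcases hb.lt_or_eq with hlt | rfl
  · have hpow := initialFormIsPowerOf_of_mem hdim h0 hm hlt hy hadm
    have hP : InitialFormIsPower h := ⟨y₂, y₁, hy.symm, hpow⟩
    have hy₁ : IsParameters x₂ y₁ :=
      hx.1.of_initialFormIsPowerOf hdim h0 hm hy.left_mem (hx.2 hP).1 hpow
    -- Only the parameter of larger value matters, so `y₂` can be exchanged for `x₂`.
    have heq := valuationIdeal_congr_right hy hy₁.symm hν' hlt.le
    have hadm' := hadm
    rw [← heq] at hadm'
    have hb₂ : (order h : ℚ) * (b₂ / order h) = b₂ := mul_div_cancel₀ _ hν'.ne'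
    have hδ : b₂ / order h ≤ δ := by
      have h1 := le_of_mem_projectedPolyhedron hdim hy₁ (δ := b₂ / order h)
        (div_pos (hν'.trans hlt) hν') (by rw [hb₂]; exact hadm')
        ((hx.2 hP).2 y₁ hy₁ (hs.mem_polyhedron hP))
      exact_mod_cast h1
    refine ⟨Prod.Lex.toLex_le_toLex.mpr (Or.inr ⟨rfl, ?_⟩), fun _ e => ?_⟩
    · change b₂ ≤ order h * δ
      rw [mul_comm]
      exact (div_le_iff₀ hν').mp hδ
    · subst e
      refine monomialValuation_congr fun t => ?_
      rw [← heq]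
      exact valuationIdeal_congr
        (hx.1.mem_valuationIdeal_of_mem hdim hν hlt hy₁ (order_spec h0).2 hs.mem hadm')
        (right_mem_valuationIdeal _ _ _ _)
        (hy₁.mem_valuationIdeal_of_mem hdim hν hlt hx.1 (order_spec h0).2 hadm' hs.mem)
        (right_mem_valuationIdeal _ _ _ _) t
  -- Equal weights: the valuation ideals are the same for all parameters.
  · refine ⟨Prod.Lex.toLex_le_toLex.mpr (Or.inr ⟨rfl, ?_⟩), fun _ e => ?_⟩
    · exact le_mul_of_one_le_right hν'.le hs.one_le
    · rw [← e]
      exact monomialValuation_congr fun t => valuationIdeal_congr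
        (hx.1.symm.mem_valuationIdeal hy.left_mem hν' le_rfl)
        (hx.1.symm.mem_valuationIdeal hy.right_mem hν' le_rfl)
        (hy.mem_valuationIdeal hx.1.right_mem hν' le_rfl)
        (hy.mem_valuationIdeal hx.1.left_mem hν' le_rfl) t

/-- Both centers are admissible and maximal, so each bounds the other, and uniqueness identifies
them. -/
theorem IsSlope.eq_of_isCharacteristic {h x₁ x₂ y₁ y₂ : O} {δ ε : ℚ} (hs : IsSlope h x₂ x₁ δ)
    (ht : IsSlope h y₂ y₁ ε) (hh : HasSingularReduction h) (hx : IsCharacteristic h x₂ x₁)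
    (hy : IsCharacteristic h y₂ y₁) :
    (order h : ℚ) * ε = order h * δ ∧ monomialValuation y₁ y₂ (order h) (order h * ε) =
      monomialValuation x₁ x₂ (order h) (order h * δ) := by
  have hν : (0 : ℚ) < order h := by exact_mod_cast order_pos hh.1 hh.2.1
  have h1 := hs.isUniqueMaximalCenter hdim hh hx
  have h2 := ht.isUniqueMaximalCenter hdim hh hy
  have h3 := h1.2 y₁ y₂ _ _ hy.1.symm hν (le_mul_of_one_le_right hν.le ht.one_le) h2.1
  have h4 := h2.2 x₁ x₂ _ _ hx.1.symm hν (le_mul_of_one_le_right hν.le hs.one_le) h1.1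
  have h5 := toLex.injective (le_antisymm h3.1 h4.1)
  exact ⟨(Prod.ext_iff.mp h5).2, h3.2 rfl (Prod.ext_iff.mp h5).2⟩

theorem IsSlope.isInvariant_iff {h x₁ x₂ : O} {δ : ℚ} (hs : IsSlope h x₂ x₁ δ)
    (hh : HasSingularReduction h) (hx : IsCharacteristic h x₂ x₁) (b : ℕ × ℚ) :
    IsInvariant h b ↔ b = (order h, order h * δ) := by
  constructor
  · rintro ⟨y₂, y₁, hy, h1, h2⟩
    obtain ⟨ε, ht⟩ := hy.exists_isSlope hdim hh
    rw [ht.delta_eq hdim hy.1, ← EReal.coe_mul, EReal.coe_eq_coe_iff] at h2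
    refine Prod.ext h1 ?_
    rw [← (hs.eq_of_isCharacteristic hdim ht hh hx hy).1]
    exact_mod_cast h2
  · rintro rfl
    refine ⟨x₂, x₁, hx, rfl, ?_⟩
    rw [hs.delta_eq hdim hx.1, ← EReal.coe_mul]
    push_cast
    rfl

theorem IsSlope.isCenter_iff {h x₁ x₂ : O} {δ : ℚ} (hs : IsSlope h x₂ x₁ δ)
    (hh : HasSingularReduction h) (hx : IsCharacteristic h x₂ x₁) (v : O → EReal) :
    IsCenter h v ↔ v = monomialValuation x₁ x₂ (order h) (order h * δ) := by
  constructor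
  · rintro ⟨y₁, y₂, a, hy, ha, rfl⟩
    obtain ⟨ε, ht⟩ := hy.exists_isSlope hdim hh
    rw [ht.isInvariant_iff hdim hh hy] at ha
    rw [ha]
    exact (hs.eq_of_isCharacteristic hdim ht hh hx hy).2
  · rintro rfl
    exact ⟨x₁, x₂, _, hx, (hs.isInvariant_iff hdim hh hx _).mpr rfl, rfl⟩

/-! ### Transfer to the leading part -/

theorem isUpperSet_projectedPolyhedron {f x z : O} (h : IsParameters x z) :
    IsUpperSet (projectedPolyhedron f x z) := by
  intro s t hst hs
  rw [mem_projectedPolyhedron_iff hdim h] at hs ⊢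
  refine fun ht => hs (monomialIdeal_subset (fun p hp => ?_) ht)
  rcases hp with hp | hp
  · exact Or.inl hp
  by_cases hν : order f ≤ p.1
  · exact Or.inl hν
  have h1 : (0 : ℝ) < (order f : ℝ) - p.1 := sub_pos.mpr (by exact_mod_cast not_le.mp hν)
  exact Or.inr ((mul_le_mul_of_nonneg_right hst h1.le).trans_lt hp)

theorem IsExpansion.sub_leadingPart_mem {f x₁ x₂ : O} {c : ℕ × ℕ →₀ O} {a₁ a₂ : ℚ}
    (hc : IsExpansion f x₁ x₂ c) (hx : IsParameters x₁ x₂) (ha₁ : 0 < a₁) (ha₂ : 0 < a₂)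
    (hf : f ∈ valuationIdeal x₁ x₂ a₁ a₂ 1) : f - leadingPart x₁ x₂ a₁ a₂ c ∈
      monomialIdeal x₁ x₂ {p | 1 < (p.1 : ℚ) / a₁ + (p.2 : ℚ) / a₂} := by
  have e : f - leadingPart x₁ x₂ a₁ a₂ c =
      ∑ p ∈ c.support with ¬ (p.1 : ℚ) / a₁ + (p.2 : ℚ) / a₂ = 1, c p * x₁ ^ p.1 * x₂ ^ p.2 := by
    rw [sub_eq_iff_eq_add', leadingPart, Finset.sum_filter_add_sum_filter_not]
    exact hc.2
  rw [e]
  refine Ideal.sum_mem _ fun p hp => ?_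
  rw [Finset.mem_filter, Finsupp.mem_support_iff] at hp
  rw [mul_assoc]
  refine Ideal.mul_mem_left _ _ (monomial_mem (lt_of_le_of_ne ?_ (Ne.symm hp.2)))
  rw [valuationIdeal_eq] at hf
  obtain ⟨q, hq, hle⟩ := hc.exists_le_of_mem hdim hx hf hp.1
  have h1 : (q.1 : ℚ) ≤ p.1 := by exact_mod_cast hle.1
  have h2 : (q.2 : ℚ) ≤ p.2 := by exact_mod_cast hle.2
  exact le_trans hq (by gcongr)

omit hdim [IsNoetherianRing O] in
theorem IsParameters.mem_pow_of_mem_lt {h y₁ y₂ : O} {n : ℕ} {b : ℚ} (hy : IsParameters y₁ y₂)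
    (hn : 0 < n) (hb : (n : ℚ) ≤ b)
    (hv : h ∈ monomialIdeal y₁ y₂ {p | 1 < (p.1 : ℚ) / n + (p.2 : ℚ) / b}) :
    h ∈ maximalIdeal O ^ (n + 1) := by
  rw [hy.pow_maximalIdeal]
  refine monomialIdeal_subset (fun p (hp : (1 : ℚ) < _) => ?_) hv
  have hn' : (0 : ℚ) < n := by exact_mod_cast hn
  have h1 : (p.2 : ℚ) / b ≤ p.2 / n := by gcongr
  have h2 : 1 < ((p.1 : ℚ) + p.2) / n := by rw [add_div]; linarith
  rw [one_lt_div hn'] at h2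
  have h4 : n < p.1 + p.2 := by exact_mod_cast h2
  exact h4

/-- If `f - g` has value larger than one, then the projected polyhedra of `g` contain the slope
of `f`: a vertex that can be removed from the polyhedron of `g` can be removed from that of `f`. -/
theorem IsSlope.mem_projectedPolyhedron_of_sub_mem {f g x₁ x₂ y : O} {δ : ℚ}
    (hs : IsSlope f x₂ x₁ δ) (h0 : f ≠ 0) (hm : f ∈ maximalIdeal O)
    (hx : IsCharacteristic f x₂ x₁) (hP : InitialFormIsPower f) (hy : IsParameters x₂ y)
    (hfg : f - g ∈ monomialIdeal x₁ x₂
      {p | 1 < (p.1 : ℚ) / order f + (p.2 : ℚ) / (order f * δ)}) :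
    (δ : ℝ) ∈ projectedPolyhedron g x₂ y := by
  have hν := order_pos h0 hm
  have hν' : (0 : ℚ) < order f := by exact_mod_cast hν
  have hδ := hs.one_lt hP
  have hδ0 : 0 < δ := zero_lt_one.trans hδ
  have hb : (order f : ℚ) < order f * δ := lt_mul_of_one_lt_right hν' hδ
  have hsub := hx.1.symm.mem_pow_of_mem_lt hν hb.le hfg
  have hordg := order_eq_of_sub_mem h0 hsub
  have hg0 : g ≠ 0 := fun e => (order_spec h0).2 (by simpa [e] using hsub)
  have hmin := (hx.2 hP).2 y hy (hs.mem_polyhedron hP)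
  rw [mem_projectedPolyhedron_iff hdim hy] at hmin ⊢
  rw [hordg]
  intro hg
  refine hmin ?_
  have hcmp : ∀ p : ℕ × ℕ, order f ≤ p.1 ∨ (δ : ℝ) * ((order f : ℝ) - p.1) < p.2 →
      1 ≤ (p.1 : ℚ) / order f + (p.2 : ℚ) / (order f * δ) := fun p hp => by
    rcases hp with hp | hp
    · have h1 : (1 : ℚ) ≤ p.1 / order f := (one_le_div hν').mpr (by exact_mod_cast hp)
      have h2 : (0 : ℚ) ≤ p.2 / (order f * δ) := by positivity
      linarith
    · have hp' : δ * ((order f : ℚ) - p.1) < p.2 := by exact_mod_cast hp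
      have e : (p.1 : ℚ) / order f + p.2 / (order f * δ) = (p.1 * δ + p.2) / (order f * δ) := by
        field_simp
      rw [e, one_le_div (by positivity)]
      linarith
  have hgy : g ∈ valuationIdeal y x₂ (order f) (order f * δ) 1 := by
    rw [valuationIdeal_eq]
    exact monomialIdeal_subset hcmp hg
  have hgx : g ∈ valuationIdeal x₁ x₂ (order f) (order f * δ) 1 := by
    have h1 : f - g ∈ valuationIdeal x₁ x₂ (order f) (order f * δ) 1 := by
      rw [valuationIdeal_eq]
      exact monomialIdeal_subset (fun p (hp : (1 : ℚ) < _) => hp.le) hfg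
    have := Ideal.sub_mem _ hs.mem h1
    rwa [sub_sub_cancel] at this
  have hordg' : g ∉ maximalIdeal O ^ (order f + 1) := hordg ▸ (order_spec hg0).2
  -- As `g` has value at least 1 in both systems, `x₁` has value at least `1 / ν` in `(y, x₂)`. So
  -- `f - g` keeps value greater than 1 there, and `f` would miss δ together with `g`.
  have hx₁ := hy.mem_valuationIdeal_of_mem hdim hν hb hx.1 hordg' hgy hgx
  have hfg' := monomialIdeal_lt_le hx₁ (right_mem_valuationIdeal _ _ _ _) _ hfg
  have hfgS : f - g ∈ monomialIdeal y x₂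
      {p | order f ≤ p.1 ∨ (δ : ℝ) * ((order f : ℝ) - (p.1 : ℝ)) < (p.2 : ℝ)} := by
    refine monomialIdeal_subset (fun p (hp : (1 : ℚ) < _) => ?_) hfg'
    right
    have e : (p.1 : ℚ) / order f + p.2 / (order f * δ) = (p.1 * δ + p.2) / (order f * δ) := by
      field_simp
    rw [e, one_lt_div (by positivity)] at hp
    have h1 : δ * ((order f : ℚ) - p.1) < p.2 := by linarith
    exact_mod_cast h1
  have := Ideal.add_mem _ hfgS hg
  rwa [sub_add_cancel] at this

/-- A perturbation of value greater than 1 lies in `𝔪 ^ (ν + 1)`, so order and initial form persist;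
the rest follows from δ lying in `Δ(g; x₂; y)` for all `y` when the initial form is a power. -/
theorem IsSlope.of_sub_mem {f g x₁ x₂ : O} {δ : ℚ} (hs : IsSlope f x₂ x₁ δ)
    (hf : HasSingularReduction f) (hx : IsCharacteristic f x₂ x₁)
    (hfg : f - g ∈ monomialIdeal x₁ x₂
      {p | 1 < (p.1 : ℚ) / order f + (p.2 : ℚ) / (order f * δ)}) :
    order g = order f ∧ HasSingularReduction g ∧ IsCharacteristic g x₂ x₁ ∧
      IsSlope g x₂ x₁ δ := by
  obtain ⟨h0, hm, -⟩ := hf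
  have hν := order_pos h0 hm
  have hν' : (0 : ℚ) < order f := by exact_mod_cast hν
  have hb : (order f : ℚ) ≤ order f * δ := le_mul_of_one_le_right hν'.le hs.one_le
  have hsub := hx.1.symm.mem_pow_of_mem_lt hν hb hfg
  have hordg := order_eq_of_sub_mem h0 hsub
  have hg0 : g ≠ 0 := fun e => (order_spec h0).2 (by simpa [e] using hsub)
  have hsub' : g - f ∈ maximalIdeal O ^ (order g + 1) := by
    rw [hordg, ← neg_sub]
    exact (Ideal.neg_mem_iff _).mpr hsub
  have hgm : g ∈ maximalIdeal O := by
    have := Ideal.sub_mem _ hm (Ideal.pow_le_self (Nat.succ_ne_zero _) hsub)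
    rwa [sub_sub_cancel] at this
  have hpow : ∀ y, InitialFormIsPowerOf g y ↔ InitialFormIsPowerOf f y := fun y =>
    ⟨initialFormIsPowerOf_of_sub_mem hg0 hsub', initialFormIsPowerOf_of_sub_mem h0 hsub⟩
  have hpow' : InitialFormIsPower g ↔ InitialFormIsPower f := by
    simp only [InitialFormIsPower, hpow]
  have hgv : g ∈ valuationIdeal x₁ x₂ (order g) (order g * δ) 1 := by
    have h1 : f - g ∈ valuationIdeal x₁ x₂ (order f) (order f * δ) 1 := by
      rw [valuationIdeal_eq]
      exact monomialIdeal_subset (fun p (hp : (1 : ℚ) < _) => hp.le) hfg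
    have := Ideal.sub_mem _ hs.mem h1
    rwa [sub_sub_cancel, ← hordg] at this
  have hkey : InitialFormIsPower g → ∀ y, IsParameters x₂ y →
      (δ : ℝ) ∈ projectedPolyhedron g x₂ y := fun hP y hy =>
    hs.mem_projectedPolyhedron_of_sub_mem hdim h0 hm hx (hpow'.mp hP) hy hfg
  refine ⟨hordg, ⟨hg0, hgm, fun hreg => ?_⟩, ⟨hx.1, fun hP => ⟨?_, fun y hy r hr => ?_⟩⟩, hgv,
    fun hP => hs.one_lt (hpow'.mp hP), fun hP => hkey hP x₁ hx.1,
    fun hP => hs.eq_one fun h => hP (hpow'.mpr h)⟩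
  -- A regular reduction makes `g` a unit times `z ^ k` with `k` its order, so `Δ(g; x₂; z)` is
  -- empty and cannot contain δ.
  · obtain ⟨w, z, u, k, hw, hu, hk, rfl⟩ :=
      exists_eq_unit_mul_pow_of_isRegular hdim hx.1 hg0 hgm hreg
    have hord := order_unit_mul_pow hdim k hw hu
    have hPz : InitialFormIsPowerOf (u * z ^ k) z := ⟨u, hu, by rw [hord]; simp⟩
    have hP : InitialFormIsPower (u * z ^ k) := ⟨w, z, hw, hPz⟩
    have hz : IsParameters x₂ z := hx.1.of_initialFormIsPowerOf hdim hg0 hgm hw.right_mem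
      ((hpow x₁).mpr (hx.2 (hpow'.mp hP)).1) hPz
    have := hkey hP z hz
    rw [mem_projectedPolyhedron_iff hdim hz, hord] at this
    refine this (Ideal.mul_mem_left _ u ?_)
    simpa using monomial_mem (x := z) (y := x₂) (p := (k, 0))
      (S := {p | k ≤ p.1 ∨ (δ : ℝ) * ((k : ℝ) - (p.1 : ℝ)) < (p.2 : ℝ)}) (Or.inl le_rfl)
  · exact (hpow x₁).mpr (hx.2 (hpow'.mp hP)).1
  -- Minimality: `Δ(g; x₂; x₁)` lies in `[δ, ∞)`, and this half-line lies in the upper set `Δ(g; x₂;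
  -- y)`.
  · have hδ := hs.one_lt (hpow'.mp hP)
    exact isUpperSet_projectedPolyhedron hdim hy
      (le_of_mem_projectedPolyhedron hdim hx.1 (zero_lt_one.trans hδ) hgv hr) (hkey hP y hy)

end PlaneCurve

open PlaneCurve in
theorem corollary3p5 (k : Type*) [Field k] {O : Type*} [CommRing O] [IsRegularLocalRing O]
    [Algebra k O] [Algebra.EssFiniteType k O] (hdim : ringKrullDim O = 2)
    (f : O) (hf : HasSingularReduction f)
    (x₁ x₂ : O) (hx : IsCharacteristic f x₂ x₁)
    (c : ℕ × ℕ →₀ O) (hc : IsExpansion f x₁ x₂ c) :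
    ∃ (a₁ : ℕ) (a₂ : ℚ), 0 < a₁ ∧ (a₁ : ℚ) ≤ a₂ ∧
      -- `(a₁, a₂)` is the invariant of `f`, and `(x₁ ^ a₁, x₂ ^ a₂)` is its centre
      (∀ b : ℕ × ℚ, IsInvariant f b ↔ b = (a₁, a₂)) ∧
      (∀ v : O → EReal, IsCenter f v ↔ v = monomialValuation x₁ x₂ a₁ a₂) ∧
      -- the leading part defines a curve with singular reduction
      HasSingularReduction (leadingPart x₁ x₂ a₁ a₂ c) ∧
      -- it has the same invariant and the same centre
      (∀ b : ℕ × ℚ, IsInvariant (leadingPart x₁ x₂ a₁ a₂ c) b ↔ b = (a₁, a₂)) ∧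
      IsCharacteristic (leadingPart x₁ x₂ a₁ a₂ c) x₂ x₁ ∧
      (∀ v : O → EReal, IsCenter (leadingPart x₁ x₂ a₁ a₂ c) v ↔
        v = monomialValuation x₁ x₂ a₁ a₂) ∧
      IsUniqueMaximalCenter (leadingPart x₁ x₂ a₁ a₂ c) x₁ x₂ a₁ a₂ := by
  obtain ⟨δ, hs⟩ := hx.exists_isSlope hdim hf
  have hν := order_pos hf.1 hf.2.1
  have hν' : (0 : ℚ) < order f := by exact_mod_cast hν
  have hb : (order f : ℚ) ≤ order f * δ := le_mul_of_one_le_right hν'.le hs.one_le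
  have hsub := hc.sub_leadingPart_mem hdim hx.1.symm hν' (hν'.trans_le hb) hs.mem
  obtain ⟨hord, hg, hgx, hgs⟩ := hs.of_sub_mem hdim hf hx hsub
  have hinv := hgs.isInvariant_iff hdim hg hgx
  have hcen := hgs.isCenter_iff hdim hg hgx
  have hmax := hgs.isUniqueMaximalCenter hdim hg hgx
  rw [hord] at hinv hcen hmax
  exact ⟨order f, order f * δ, hν, hb, hs.isInvariant_iff hdim hf hx, hs.isCenter_iff hdim hf hx,
    hg, hinv, hgx, hcen, hmax⟩
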